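/- **Theorem 1 (soundness of the dependent refinement type system for $\lambda_{\mathrm{HFL}}$).** *Models.* Let $\mathcal C$ be an $\omega$CPO-enriched bicartesian closed category: hom-sets are $\omega$-cpos (least elements are not required), composition is $\omega$-Scott-continuous, and the bijections given by finite products, finite coproducts and exponentials are isomorphisms of $\omega$-cpos. An object $A$ *has a bottom element* if $\mathcal C(1,A)$ has a least element $\bot^A$. A *lifting strong monad* consists, for each $X$, of an object $X_\bot$ with a bottom element and $\eta_X:X\to X_\bot$ such that for every $A$ with a bottom element and every $f:X\to A$ there is a unique $\overline f:X_\bot\to A$ with $\overline f\circ\eta_X=f$ and $\overline f\circ\bot^{X_\bot}=\bot^A$, together with a strength for the induced monad $T=(-)_\bot$. If $\nu:TA\to A$ is the structure map of an Eilenberg–Moore algebra, $X\Rightarrow A$ carries the structure map $\nu^X$ that is the currying of $T(X\Rightarrow A)\times X\to T((X\Rightarrow A)\times X)\xrightarrow{T\mathbf{ev}}TA\xrightarrow{\nu}A$. For $f:I\times A\to A$, the parameterised fixed point $f^\dagger:I\to A$ is $\Lambda^{-1}(\nu^I)\circ\langle \sup_n \lceil f\rceil^n\circ\bot\circ{!},\mathrm{id}\rangle$,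 where $\lceil f\rceil=\eta\circ\Lambda(f\circ\langle\pi_2,\Lambda^{-1}(\nu^I)\rangle):T(I\Rightarrow A)\to T(I\Rightarrow A)$ (the parameterised least fixed point of $f$). Fix a set of base types $b$ and a set of basic operators $\mathbf{op}$ with types $\mathrm{ar}(\mathbf{op}),\mathrm{car}(\mathbf{op})$. A *$\lambda_{\mathrm{HFL}}$-model* on $\mathcal C$ consists of a lifting strong monad, an object $Ab$ for each base type, an object $\Omega$ with a bottom element $\bot^\Omega$, and a morphism $a(\mathbf{op}):\llbracket\mathrm{ar}(\mathbf{op})\rrbracket\to\llbracket\mathrm{car}(\mathbf{op})\rrbracket$ for each operator. *Terms.* Simple types are $\sigma,\tau::=\mathbf{Prop}\mid b\mid 1\mid\sigma\times\tau\mid 0\mid\sigma+\tau\mid\sigma\to\mathbf{Prop}$, interpreted by $\Omega$, $Ab$ and the bicartesian closed structure; contexts are interpreted as products. Terms are those of the simply typed $\lambda$-calculus: variables, $\mathbf{op}\,M$, $()$, $(M,N)$, $\pi_iM$, $\delta(M)$ (case on $0$), $\iota_iM$, $\delta(M,x_1.N_1,x_2.N_2)$ (case on a sum), $\lambda x:\sigma.M:\sigma\to\mathbf{Prop}$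 for $M:\mathbf{Prop}$, $M\,N$, and $\mathbf{fix}\,f.M:\sigma\to\mathbf{Prop}$ for $M:\sigma\to\mathbf{Prop}$ in a context with $f:\sigma\to\mathbf{Prop}$. They are interpreted as morphisms $\llbracket M\rrbracket:\llbracket\Gamma\rrbracket\to\llbracket\sigma\rrbracket$ in the standard way, with $\llbracket\mathbf{fix}\,f.M\rrbracket=\llbracket M\rrbracket^\dagger$ for the algebra on $\llbracket\sigma\rrbracket\Rightarrow\Omega$ induced by $\bot^\Omega$. Variables in a context are distinct, and terms are taken up to renaming of bound variables. *Formulas and refinement types.* Formulas are $\phi::=\mathbf{ap}(M)\mid\top\mid\bot\mid\phi\Rightarrow\psi\mid\phi\wedge\psi\mid\phi\vee\psi$. Each atomic predicate is interpreted as a set of global elements $1\to\llbracket\mathrm{ar}(\mathbf{ap})\rrbracket$; they include $\le_{\mathbf{Prop}}$, interpreted as the order of $\mathcal C(1,\Omega)$, and $=_b$, interpreted as equality in $\mathcal C(1,Ab)$. A formula $\Gamma\vdash\phi$ denotes a set of global elements $\gamma:1\to\llbracket\Gamma\rrbracket$: $\mathbf{ap}(M)$ holds at $\gamma$ iff $\llbracket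 M\rrbracket\circ\gamma\in\llbracket\mathbf{ap}\rrbracket$, and connectives are classical. Refinement types are $$\dot\sigma,\dot\tau::=\{v:\sigma\mid\phi\}\ (\sigma=b,\mathbf{Prop},1)\mid(x:\dot\sigma)\times\dot\tau\mid0\mid\dot\sigma+\dot\tau\mid(x:\dot\sigma)\to\{v:\mathbf{Prop}\mid\phi\},$$ and refinement contexts are $\dot\Gamma::=\cdot\mid\dot\Gamma,x:\dot\sigma$. Erasing formulas gives the underlying simple types and contexts $|\dot\sigma|,|\dot\Gamma|$. Only well-formed contexts and types are considered, i.e. all formulas are well typed over the underlying contexts. The predicate part $\llbracket\dot\Gamma\rrbracket_2\subseteq\mathcal C(1,\llbracket|\dot\Gamma|\rrbracket)$ is defined as follows: $\llbracket\cdot\rrbracket_2=\mathcal C(1,1)$, and for $i\in\mathcal C(1,\llbracket|\dot\Gamma|\rrbracket)$ and $y\in\mathcal C(1,\llbracket|\dot\rho|\rrbracket)$, - $\langle i,y\rangle\in\llbracket\dot\Gamma,r:\{v:\sigma\mid\phi\}\rrbracket_2$ iff $i\in\llbracket\dot\Gamma\rrbracket_2$ and $\phi$ holds at $\langle i,y\rangle$;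 - $\langle i,\langle x,y\rangle\rangle\in\llbracket\dot\Gamma,r:(x:\dot\sigma)\times\dot\tau\rrbracket_2$ iff $\langle\langle i,x\rangle,y\rangle\in\llbracket\dot\Gamma,x:\dot\sigma,y:\dot\tau\rrbracket_2$; - $\llbracket\dot\Gamma,r:0\rrbracket_2=\emptyset$; - $\llbracket\dot\Gamma,r:\dot\sigma_1+\dot\sigma_2\rrbracket_2=\bigcup_{k=1,2}\{\langle i,\iota_k\circ x\rangle\mid\langle i,x\rangle\in\llbracket\dot\Gamma,x:\dot\sigma_k\rrbracket_2\}$; - $\langle i,f\rangle\in\llbracket\dot\Gamma,r:(x:\dot\sigma)\to\{v:\mathbf{Prop}\mid\phi\}\rrbracket_2$ iff $i\in\llbracket\dot\Gamma\rrbracket_2$ and for all $x:1\to\llbracket|\dot\sigma|\rrbracket$, $\langle i,x\rangle\in\llbracket\dot\Gamma,x:\dot\sigma\rrbracket_2$ implies $\langle\langle i,x\rangle,\mathbf{ev}\circ\langle f,x\rangle\rangle\in\llbracket\dot\Gamma,x:\dot\sigma,v:\{v:\mathbf{Prop}\mid\phi\}\rrbracket_2$. *Subtyping.* $\dot\Gamma\vdash\dot\sigma<:\dot\tau$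 is the least reflexive and transitive relation with: $\{v:\sigma\mid\phi\}<:\{v:\sigma\mid\psi\}$ if $\psi$ holds at every $\langle i,y\rangle$ with $i\in\llbracket\dot\Gamma\rrbracket_2$ at which $\phi$ holds; $(x:\dot\sigma_1)\to\dot\tau_1<:(x:\dot\sigma_2)\to\dot\tau_2$ if $\dot\Gamma\vdash\dot\sigma_2<:\dot\sigma_1$ and $\dot\Gamma,x:\dot\sigma_2\vdash\dot\tau_1<:\dot\tau_2$; $(x:\dot\sigma_1)\times\dot\tau_1<:(x:\dot\sigma_2)\times\dot\tau_2$ if $\dot\Gamma\vdash\dot\sigma_1<:\dot\sigma_2$ and $\dot\Gamma,x:\dot\sigma_1\vdash\dot\tau_1<:\dot\tau_2$; and $\dot\sigma_1+\dot\tau_1<:\dot\sigma_2+\dot\tau_2$ if $\dot\sigma_1<:\dot\sigma_2$ and $\dot\tau_1<:\dot\tau_2$. *Typing.* $\dot\Gamma\vdash M:\dot\sigma$ is generated by the following rules. - (Sub) If $\dot\Gamma\vdash M:\dot\sigma$ and $\dot\Gamma\vdash\dot\sigma<:\dot\tau$, then $\dot\Gamma\vdash M:\dot\tau$. - (App) If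 $\dot\Gamma\vdash M:(x:\dot\sigma)\to\{v:\mathbf{Prop}\mid\phi\}$ and $\dot\Gamma\vdash N:\dot\sigma$, then $\dot\Gamma\vdash M\,N:\{v:\mathbf{Prop}\mid\phi[N/x]\}$. - (Abs) If $\dot\Gamma,x:\dot\sigma\vdash M:\{v:\mathbf{Prop}\mid\phi\}$, then $\dot\Gamma\vdash\lambda x.M:(x:\dot\sigma)\to\{v:\mathbf{Prop}\mid\phi\}$. - (Unit) $\dot\Gamma\vdash():\{v:1\mid\top\}$. - (Pair) If $\dot\Gamma\vdash M:\dot\sigma$ and $\dot\Gamma\vdash N:\dot\tau[M/x]$, then $\dot\Gamma\vdash(M,N):(x:\dot\sigma)\times\dot\tau$. - (Fst, Snd) If $\dot\Gamma\vdash M:(x:\dot\sigma)\times\dot\tau$, then $\dot\Gamma\vdash\pi_1M:\dot\sigma$ and $\dot\Gamma\vdash\pi_2M:\dot\tau[\pi_1M/x]$. - (Case0) If $\dot\Gamma\vdash M:0$ and $\dot\Gamma\vdash\dot\tau$ is well formed, then $\dot\Gamma\vdash\delta(M):\dot\tau$. - (Inj) If $\dot\Gamma\vdash M:\dot\sigma_i$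 and $\dot\Gamma\vdash\dot\sigma_{3-i}$ is well formed, then $\dot\Gamma\vdash\iota_iM:\dot\sigma_1+\dot\sigma_2$. - (Case2) If $\dot\Gamma,z:\dot\sigma_1+\dot\sigma_2\vdash\dot\tau$ is well formed, $\dot\Gamma\vdash M:\dot\sigma_1+\dot\sigma_2$ and $\dot\Gamma,x_i:\dot\sigma_i\vdash N_i:\dot\tau[\iota_ix_i/z]$ for $i=1,2$, then $\dot\Gamma\vdash\delta(M,x_1.N_1,x_2.N_2):\dot\tau[M/z]$. - (VarRefine) If $(x:\{v:b\mid\phi\})\in\dot\Gamma$, then $\dot\Gamma\vdash x:\{v:b\mid v=_bx\}$. - (Var) If $(x:\dot\sigma)\in\dot\Gamma$, then $\dot\Gamma\vdash x:\dot\sigma$. - (Fix) If $\dot\Gamma,f:\dot\tau\vdash M:\dot\tau$ for $\dot\tau=(x:\dot\sigma)\to\{v:\mathbf{Prop}\mid\phi\}$ and $|\dot\Gamma|,x:|\dot\sigma|,v:\mathbf{Prop}\vdash\phi$ is admissible at $v$, i.e. for each $\gamma$ the set of $u\in\mathcal C(1,\Omega)$ such that $\phi$ holds at $\gamma[v\mapsto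 u]$ contains $\bot^\Omega$ and is closed under suprema of $\omega$-chains, then $\dot\Gamma\vdash\mathbf{fix}\,f.M:\dot\tau$. - (BasicOp) If $\dot\Gamma\vdash M:\dot\sigma$, $\dot\Gamma\vdash\dot\tau$ is well formed, $\mathrm{ar}(\mathbf{op})=|\dot\sigma|$, $\mathrm{car}(\mathbf{op})=|\dot\tau|$, and $(\mathrm{id}\times a(\mathbf{op}))\circ p\in\llbracket\dot\Gamma,v:\dot\tau\rrbracket_2$ for all $p\in\llbracket\dot\Gamma,v:\dot\sigma\rrbracket_2$, then $\dot\Gamma\vdash\mathbf{op}(M):\dot\tau$. *Conclusion.* For any $\lambda_{\mathrm{HFL}}$-model and any interpretation of the atomic predicates, if $\dot\Gamma\vdash M:\dot\sigma$ is derivable, then for every $\gamma\in\llbracket\dot\Gamma\rrbracket_2$ we have $\langle\gamma,\llbracket M\rrbracket\circ\gamma\rangle\in\llbracket\dot\Gamma,r:\dot\sigma\rrbracket_2$. -/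

import Mathlib

open CategoryTheory MonoidalCategory CartesianMonoidalCategory MonoidalClosed

universe v u a b c

noncomputable section

namespace HFL

/-! ## Simple types, contexts, terms

Variables are de Bruijn indices and terms are intrinsically typed: an element of `Tm S Γ σ` is a
well-typed term `Γ ⊢ M : σ`. Contexts are lists of types, the most recent variable first. -/

/-- Simple types over a set `B` of base types; function types are `σ → Prop`. -/
inductive Ty (B : Type a) : Type a
  | prop : Ty B
  | base : B → Ty B
  | unit : Ty B
  | prod : Ty B → Ty B → Ty B
  | empty : Ty B
  | sum : Ty B → Ty B → Ty B
  | arr : Ty B → Ty B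

/-- The types in `Base ∪ {Prop, 1}`, i.e. those `σ` for which `{v : σ | φ}` is formed. -/
def Ty.IsGround {B : Type a} : Ty B → Prop
  | .prop => True
  | .base _ => True
  | .unit => True
  | _ => False

/-- The syntactic parameters: base types, basic operators `op : ar op ⇾ car op`, and atomic
predicates with their arities. The atomic predicates `≤_Prop` and `=_b`, which are always present,
are added separately in `Atom`, so `AP` lists only the remaining ones. -/
structure Signature where
  Base : Type a
  BO : Type b
  ar : BO → Ty Base
  car : BO → Ty Base
  AP : Type c
  arAP : AP → Ty Base

abbrev Ctx (S : Signature.{a, b, c}) : Type a := List (Ty S.Base)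

/-- `Var Γ σ`: the variables of type `σ` in `Γ`. -/
inductive Var {B : Type a} : List (Ty B) → Ty B → Type a
  | zero {Γ : List (Ty B)} {σ : Ty B} : Var (σ :: Γ) σ
  | succ {Γ : List (Ty B)} {σ τ : Ty B} : Var Γ σ → Var (τ :: Γ) σ

/-- Well-typed terms `Γ ⊢ M : σ`. -/
inductive Tm (S : Signature.{a, b, c}) : Ctx S → Ty S.Base → Type (max a b)
  | var {Γ : Ctx S} {σ : Ty S.Base} : Var Γ σ → Tm S Γ σ
  | op {Γ : Ctx S} (o : S.BO) : Tm S Γ (S.ar o) → Tm S Γ (S.car o)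
  | unit {Γ : Ctx S} : Tm S Γ .unit
  | pair {Γ : Ctx S} {σ τ : Ty S.Base} : Tm S Γ σ → Tm S Γ τ → Tm S Γ (.prod σ τ)
  | fst {Γ : Ctx S} {σ τ : Ty S.Base} : Tm S Γ (.prod σ τ) → Tm S Γ σ
  | snd {Γ : Ctx S} {σ τ : Ty S.Base} : Tm S Γ (.prod σ τ) → Tm S Γ τ
  | caseEmpty {Γ : Ctx S} {τ : Ty S.Base} : Tm S Γ .empty → Tm S Γ τ
  | inl {Γ : Ctx S} {σ τ : Ty S.Base} : Tm S Γ σ → Tm S Γ (.sum σ τ)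
  | inr {Γ : Ctx S} {σ τ : Ty S.Base} : Tm S Γ τ → Tm S Γ (.sum σ τ)
  | caseSum {Γ : Ctx S} {σ₁ σ₂ τ : Ty S.Base} :
      Tm S Γ (.sum σ₁ σ₂) → Tm S (σ₁ :: Γ) τ → Tm S (σ₂ :: Γ) τ → Tm S Γ τ
  | lam {Γ : Ctx S} {σ : Ty S.Base} : Tm S (σ :: Γ) .prop → Tm S Γ (.arr σ)
  | app {Γ : Ctx S} {σ : Ty S.Base} : Tm S Γ (.arr σ) → Tm S Γ σ → Tm S Γ .prop
  | fix {Γ : Ctx S} {σ : Ty S.Base} : Tm S (.arr σ :: Γ) (.arr σ) → Tm S Γ (.arr σ)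

/-! ### Renaming and substitution -/

section Substitution

variable {S : Signature.{a, b, c}}

/-- A renaming of the variables of `Γ` by variables of `Δ`. -/
def Ren (Γ Δ : Ctx S) : Type a := ∀ σ : Ty S.Base, Var Γ σ → Var Δ σ

/-- A simultaneous substitution of terms in context `Δ` for the variables of `Γ`. -/
def Subst (Γ Δ : Ctx S) : Type (max a b) := ∀ σ : Ty S.Base, Var Γ σ → Tm S Δ σ

/-- The renaming under one more bound variable. -/
def Ren.up {Γ Δ : Ctx S} (r : Ren Γ Δ) (τ : Ty S.Base) : Ren (S := S) (τ :: Γ) (τ :: Δ)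
  | _, .zero => .zero
  | _, .succ x => .succ (r _ x)

/-- Weakening by the most recent variable. -/
def Ren.wk {Γ : Ctx S} {τ : Ty S.Base} : Ren (S := S) Γ (τ :: Γ) := fun _ x => .succ x

def Tm.rename : {Γ Δ : Ctx S} → {σ : Ty S.Base} → Ren Γ Δ → Tm S Γ σ → Tm S Δ σ
  | _, _, _, r, .var x => .var (r _ x)
  | _, _, _, r, .op o M => .op o (M.rename r)
  | _, _, _, _, .unit => .unit
  | _, _, _, r, .pair M N => .pair (M.rename r) (N.rename r)
  | _, _, _, r, .fst M => .fst (M.rename r)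
  | _, _, _, r, .snd M => .snd (M.rename r)
  | _, _, _, r, .caseEmpty M => .caseEmpty (M.rename r)
  | _, _, _, r, .inl M => .inl (M.rename r)
  | _, _, _, r, .inr M => .inr (M.rename r)
  | _, _, _, r, .caseSum M N₁ N₂ =>
      .caseSum (M.rename r) (N₁.rename (r.up _)) (N₂.rename (r.up _))
  | _, _, _, r, .lam M => .lam (M.rename (r.up _))
  | _, _, _, r, .app M N => .app (M.rename r) (N.rename r)
  | _, _, _, r, .fix M => .fix (M.rename (r.up _))

/-- The substitution under one more bound variable. -/
def Subst.up {Γ Δ : Ctx S} (s : Subst Γ Δ) (τ : Ty S.Base) : Subst (S := S) (τ :: Γ) (τ :: Δ)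
  | _, .zero => .var .zero
  | _, .succ x => (s _ x).rename Ren.wk

def Tm.subst : {Γ Δ : Ctx S} → {σ : Ty S.Base} → Subst Γ Δ → Tm S Γ σ → Tm S Δ σ
  | _, _, _, s, .var x => s _ x
  | _, _, _, s, .op o M => .op o (M.subst s)
  | _, _, _, _, .unit => .unit
  | _, _, _, s, .pair M N => .pair (M.subst s) (N.subst s)
  | _, _, _, s, .fst M => .fst (M.subst s)
  | _, _, _, s, .snd M => .snd (M.subst s)
  | _, _, _, s, .caseEmpty M => .caseEmpty (M.subst s)
  | _, _, _, s, .inl M => .inl (M.subst s)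
  | _, _, _, s, .inr M => .inr (M.subst s)
  | _, _, _, s, .caseSum M N₁ N₂ =>
      .caseSum (M.subst s) (N₁.subst (s.up _)) (N₂.subst (s.up _))
  | _, _, _, s, .lam M => .lam (M.subst (s.up _))
  | _, _, _, s, .app M N => .app (M.subst s) (N.subst s)
  | _, _, _, s, .fix M => .fix (M.subst (s.up _))

/-- The renaming `r` as a substitution. -/
def Ren.toSubst {Γ Δ : Ctx S} (r : Ren Γ Δ) : Subst Γ Δ := fun _ x => .var (r _ x)

/-- The substitution `[M / x]` for the most recent variable `x`, the identity elsewhere. -/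
def Subst.single {Γ : Ctx S} {τ : Ty S.Base} (M : Tm S Γ τ) : Subst (S := S) (τ :: Γ) Γ
  | _, .zero => M
  | _, .succ x => .var x

/-- For `M` in context `Γ, x : σ`, the substitution `[M / z]` from `Γ, z : τ` to `Γ, x : σ`. -/
def Subst.replace {Γ : Ctx S} {σ τ : Ty S.Base} (M : Tm S (σ :: Γ) τ) :
    Subst (S := S) (τ :: Γ) (σ :: Γ)
  | _, .zero => M
  | _, .succ x => .var (.succ x)

end Substitution

/-! ## Formulas and refinement types -/

/-- Atomic predicates: `≤_Prop`, `=_b` for each base type, and those of the signature. -/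
inductive Atom (S : Signature.{a, b, c}) : Type (max a c)
  | leProp : Atom S
  | eqBase : S.Base → Atom S
  | ap : S.AP → Atom S

def Atom.arity {S : Signature.{a, b, c}} : Atom S → Ty S.Base
  | .leProp => .prod .prop .prop
  | .eqBase t => .prod (.base t) (.base t)
  | .ap p => S.arAP p

/-- Well-formed formulas `Γ ⊢ φ`. -/
inductive Form (S : Signature.{a, b, c}) (Γ : Ctx S) : Type (max a b c)
  | atom (p : Atom S) : Tm S Γ p.arity → Form S Γ
  | top : Form S Γ
  | bot : Form S Γ
  | imp : Form S Γ → Form S Γ → Form S Γ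
  | and : Form S Γ → Form S Γ → Form S Γ
  | or : Form S Γ → Form S Γ → Form S Γ

def Form.subst {S : Signature.{a, b, c}} {Γ Δ : Ctx S} (s : Subst Γ Δ) : Form S Γ → Form S Δ
  | .atom p M => .atom p (M.subst s)
  | .top => .top
  | .bot => .bot
  | .imp φ ψ => .imp (φ.subst s) (ψ.subst s)
  | .and φ ψ => .and (φ.subst s) (ψ.subst s)
  | .or φ ψ => .or (φ.subst s) (ψ.subst s)

/-- Refinement types. An element of `RTy S Γ σ` is a refinement type with underlying type `σ` all
of whose formulas are well-formed over the simple context `Γ` (extended by the bound variables). -/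
inductive RTy (S : Signature.{a, b, c}) : Ctx S → Ty S.Base → Type (max a b c)
  /-- `{v : σ | φ}` with `σ ∈ Base ∪ {Prop, 1}` -/
  | refine {Γ : Ctx S} (σ : Ty S.Base) (hσ : σ.IsGround) (φ : Form S (σ :: Γ)) : RTy S Γ σ
  /-- `(x : A) × B` -/
  | sigma {Γ : Ctx S} {σ τ : Ty S.Base} (A : RTy S Γ σ) (B : RTy S (σ :: Γ) τ) :
      RTy S Γ (.prod σ τ)
  /-- `0` -/
  | empty {Γ : Ctx S} : RTy S Γ .empty
  /-- `A₁ + A₂` -/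
  | sum {Γ : Ctx S} {σ₁ σ₂ : Ty S.Base} (A₁ : RTy S Γ σ₁) (A₂ : RTy S Γ σ₂) :
      RTy S Γ (.sum σ₁ σ₂)
  /-- `(x : A) → {v : Prop | φ}` -/
  | pi {Γ : Ctx S} {σ : Ty S.Base} (A : RTy S Γ σ) (φ : Form S (.prop :: σ :: Γ)) :
      RTy S Γ (.arr σ)

/-- `{v : Prop | φ}` -/
abbrev RTy.prop {S : Signature.{a, b, c}} {Γ : Ctx S} (φ : Form S (.prop :: Γ)) :
    RTy S Γ .prop := .refine .prop trivial φ

/-- `{v : b | φ}` for a base type `b` -/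
abbrev RTy.base {S : Signature.{a, b, c}} {Γ : Ctx S} (t : S.Base) (φ : Form S (.base t :: Γ)) :
    RTy S Γ (.base t) := .refine (.base t) trivial φ

def RTy.subst {S : Signature.{a, b, c}} :
    {Γ Δ : Ctx S} → {σ : Ty S.Base} → Subst Γ Δ → RTy S Γ σ → RTy S Δ σ
  | _, _, _, s, .refine σ hσ φ => .refine σ hσ (φ.subst (s.up _))
  | _, _, _, s, .sigma A B => .sigma (A.subst s) (B.subst (s.up _))
  | _, _, _, _, .empty => .empty
  | _, _, _, s, .sum A₁ A₂ => .sum (A₁.subst s) (A₂.subst s)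
  | _, _, _, s, .pi A φ => .pi (A.subst s) (φ.subst ((s.up _).up _))

/-- `A[M / x]` for the most recent variable `x`. -/
def RTy.inst {S : Signature.{a, b, c}} {Γ : Ctx S} {σ τ : Ty S.Base}
    (A : RTy S (τ :: Γ) σ) (M : Tm S Γ τ) : RTy S Γ σ := A.subst (Subst.single M)

/-- Weakening of a refinement type by the most recent variable. -/
def RTy.wk {S : Signature.{a, b, c}} {Γ : Ctx S} {σ τ : Ty S.Base} (A : RTy S Γ σ) :
    RTy S (τ :: Γ) σ := A.subst Ren.wk.toSubst

/-- Well-formed refinement contexts with underlying simple context `Γ`. -/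
inductive RCtx (S : Signature.{a, b, c}) : Ctx S → Type (max a b c)
  | nil : RCtx S []
  | snoc {Γ : Ctx S} {σ : Ty S.Base} : RCtx S Γ → RTy S Γ σ → RCtx S (σ :: Γ)

/-- The refinement type assigned to a variable, weakened to the whole context. -/
def RCtx.lookup {S : Signature.{a, b, c}} :
    {Γ : Ctx S} → {σ : Ty S.Base} → RCtx S Γ → Var Γ σ → RTy S Γ σ
  | _, _, .snoc _ A, .zero => A.wk
  | _, _, .snoc G _, .succ x => (G.lookup x).wk

/-! ## Models -/

/-- A choice of an initial object and of binary coproducts. -/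
class FiniteCoproducts (C : Type u) [Category.{v} C] where
  zero : C
  isInitial : Limits.IsInitial zero
  plus : C → C → C
  inl : ∀ X Y : C, X ⟶ plus X Y
  inr : ∀ X Y : C, Y ⟶ plus X Y
  isCoproduct : ∀ X Y : C, Limits.IsColimit (Limits.BinaryCofan.mk (inl X Y) (inr X Y))

namespace FiniteCoproducts

variable {C : Type u} [Category.{v} C] [FiniteCoproducts C]

/-- The unique morphism from the initial object. -/
def initialTo (X : C) : zero (C := C) ⟶ X := (isInitial (C := C)).to X

/-- Copairing `[f, g]`. -/
def desc {X Y Z : C} (f : X ⟶ Z) (g : Y ⟶ Z) : plus X Y ⟶ Z :=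
  Limits.BinaryCofan.IsColimit.desc (isCoproduct X Y) f g

theorem inl_desc {X Y Z : C} (f : X ⟶ Z) (g : Y ⟶ Z) : inl X Y ≫ desc f g = f :=
  Limits.BinaryCofan.IsColimit.inl_desc (isCoproduct X Y) f g

theorem inr_desc {X Y Z : C} (f : X ⟶ Z) (g : Y ⟶ Z) : inr X Y ≫ desc f g = g :=
  Limits.BinaryCofan.IsColimit.inr_desc (isCoproduct X Y) f g

theorem hom_ext {X Y Z : C} {f g : plus X Y ⟶ Z} (h₁ : inl X Y ≫ f = inl X Y ≫ g)
    (h₂ : inr X Y ≫ f = inr X Y ≫ g) : f = g :=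
  Limits.BinaryCofan.IsColimit.hom_ext (isCoproduct X Y) h₁ h₂

variable [CartesianMonoidalCategory C] [MonoidalClosed C]

/-- The canonical morphism `[id × ι₁, id × ι₂] : I × X + I × Y ⟶ I × (X + Y)`. -/
def distrib (I X Y : C) : plus (I ⊗ X) (I ⊗ Y) ⟶ I ⊗ plus X Y :=
  desc (I ◁ inl X Y) (I ◁ inr X Y)

instance isIso_distrib (I X Y : C) : IsIso (distrib I X Y) := by
  refine ⟨uncurry (desc (curry (inl (I ⊗ X) (I ⊗ Y))) (curry (inr (I ⊗ X) (I ⊗ Y)))), ?_, ?_⟩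
  · apply hom_ext
    · rw [← Category.assoc, distrib, inl_desc, ← uncurry_natural_left, inl_desc, uncurry_curry,
        Category.comp_id]
    · rw [← Category.assoc, distrib, inr_desc, ← uncurry_natural_left, inr_desc, uncurry_curry,
        Category.comp_id]
  · apply curry_injective
    apply hom_ext
    · rw [← curry_natural_left, ← curry_natural_left, ← Category.assoc, ← uncurry_natural_left,
        inl_desc, uncurry_curry, distrib, inl_desc, Category.comp_id]
    · rw [← curry_natural_left, ← curry_natural_left, ← Category.assoc, ← uncurry_natural_left,
        inr_desc, uncurry_curry, distrib, inr_desc, Category.comp_id]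

/-- The inverse of the canonical morphism. -/
def distribInv (I X Y : C) : I ⊗ plus X Y ⟶ plus (I ⊗ X) (I ⊗ Y) := inv (distrib I X Y)

end FiniteCoproducts

open FiniteCoproducts

/-- An enrichment of a bicartesian closed category in `ω`-cpos: hom-sets are `ω`-cpos, and
composition, pairing, copairing and currying are `ω`-Scott-continuous. (The inverses of pairing,
copairing and currying are then continuous as well, so these bijections are isomorphisms of
`ω`-cpos.) -/
class OmegaCPOEnriched (C : Type u) [Category.{v} C] [CartesianMonoidalCategory C]
    [MonoidalClosed C] [FiniteCoproducts C] where
  homOrder : ∀ X Y : C, OmegaCompletePartialOrder (X ⟶ Y)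
  comp_continuous : ∀ X Y Z : C, OmegaCompletePartialOrder.ωScottContinuous
    (fun p : (X ⟶ Y) × (Y ⟶ Z) => p.1 ≫ p.2)
  lift_continuous : ∀ X Y Z : C, OmegaCompletePartialOrder.ωScottContinuous
    (fun p : (X ⟶ Y) × (X ⟶ Z) => lift p.1 p.2)
  desc_continuous : ∀ X Y Z : C, OmegaCompletePartialOrder.ωScottContinuous
    (fun p : (X ⟶ Z) × (Y ⟶ Z) => desc p.1 p.2)
  curry_continuous : ∀ X Y Z : C, OmegaCompletePartialOrder.ωScottContinuous
    (fun f : X ⊗ Y ⟶ Z => curry f)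

instance (priority := 100) homOmegaCPO {C : Type u} [Category.{v} C] [CartesianMonoidalCategory C]
    [MonoidalClosed C] [FiniteCoproducts C] [OmegaCPOEnriched C] (X Y : C) :
    OmegaCompletePartialOrder (X ⟶ Y) := OmegaCPOEnriched.homOrder X Y

section Models

variable {C : Type u} [Category.{v} C] [CartesianMonoidalCategory C]
  [MonoidalClosed C] [FiniteCoproducts C] [OmegaCPOEnriched C]

/-- Free algebras for the theory of one constant `⊥` with `⊥ ≤ x`: an algebra is an object `A`
with a least global element `1 ⟶ A`, a homomorphism is a morphism that preserves it, and `obj X` is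
the free algebra `X_⊥` on `X`, with unit `unit X`. -/
structure LiftingMonad (C : Type u) [Category.{v} C] [CartesianMonoidalCategory C]
    [MonoidalClosed C] [FiniteCoproducts C] [OmegaCPOEnriched C] where
  obj : C → C
  bot : ∀ X : C, 𝟙_ C ⟶ obj X
  isBot_bot : ∀ X : C, IsBot (bot X)
  unit : ∀ X : C, X ⟶ obj X
  existsUnique_ext : ∀ {X A : C} (x : 𝟙_ C ⟶ A), IsBot x → ∀ f : X ⟶ A,
    ∃! g : obj X ⟶ A, unit X ≫ g = f ∧ bot X ≫ g = x

namespace LiftingMonad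

variable (T : LiftingMonad C)

/-- The homomorphic extension of `f` to the free algebra. -/
def ext {X A : C} (x : 𝟙_ C ⟶ A) (hx : IsBot x) (f : X ⟶ A) : T.obj X ⟶ A :=
  (T.existsUnique_ext x hx f).choose

theorem unit_ext {X A : C} (x : 𝟙_ C ⟶ A) (hx : IsBot x) (f : X ⟶ A) :
    T.unit X ≫ T.ext x hx f = f :=
  (T.existsUnique_ext x hx f).choose_spec.1.1

theorem bot_ext {X A : C} (x : 𝟙_ C ⟶ A) (hx : IsBot x) (f : X ⟶ A) :
    T.bot X ≫ T.ext x hx f = x :=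
  (T.existsUnique_ext x hx f).choose_spec.1.2

/-- The functor part of the induced monad. -/
def map {X Y : C} (f : X ⟶ Y) : T.obj X ⟶ T.obj Y :=
  T.ext (T.bot Y) (T.isBot_bot Y) (f ≫ T.unit Y)

/-- The multiplication of the induced monad. -/
def mult (X : C) : T.obj (T.obj X) ⟶ T.obj X :=
  T.ext (T.bot X) (T.isBot_bot X) (𝟙 (T.obj X))

/-- A strength for the induced monad. -/
structure Strength where
  st : ∀ X Y : C, X ⊗ T.obj Y ⟶ T.obj (X ⊗ Y)
  naturality : ∀ {X X' Y Y' : C} (f : X ⟶ X') (g : Y ⟶ Y'),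
    (f ⊗ₘ T.map g) ≫ st X' Y' = st X Y ≫ T.map (f ⊗ₘ g)
  st_leftUnitor : ∀ Y : C, st (𝟙_ C) Y ≫ T.map (λ_ Y).hom = (λ_ (T.obj Y)).hom
  st_associator : ∀ X Y Z : C,
    st (X ⊗ Y) Z ≫ T.map (α_ X Y Z).hom = (α_ X Y (T.obj Z)).hom ≫ X ◁ st Y Z ≫ st X (Y ⊗ Z)
  unit_st : ∀ X Y : C, X ◁ T.unit Y ≫ st X Y = T.unit (X ⊗ Y)
  mult_st : ∀ X Y : C,
    X ◁ T.mult Y ≫ st X Y = st X (T.obj Y) ≫ T.map (st X Y) ≫ T.mult (X ⊗ Y)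

/-- The Eilenberg-Moore structure map of an object with a bottom element. -/
def algOfBot {A : C} (x : 𝟙_ C ⟶ A) (hx : IsBot x) : T.obj A ⟶ A := T.ext x hx (𝟙 A)

variable {T} (str : T.Strength)

/-- The Eilenberg-Moore structure map on the exponential `X ⇒ A` induced by one on `A`. -/
def Strength.algExp (X : C) {A : C} (ν : T.obj A ⟶ A) : T.obj ((ihom X).obj A) ⟶ ((ihom X).obj A) :=
  curry (str.st X ((ihom X).obj A) ≫ T.map ((ihom.ev X).app A) ≫ ν)

/-- The chain `⊥ ≤ ⊥ ≫ f ≤ ⊥ ≫ f ≫ f ≤ ...` of global elements of `X_⊥`. -/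
def iterate (T : LiftingMonad C) {X : C} (f : T.obj X ⟶ T.obj X) : ℕ → (𝟙_ C ⟶ T.obj X)
  | 0 => T.bot X
  | n + 1 => iterate T f n ≫ f

theorem iterate_le_succ (T : LiftingMonad C) {X : C} (f : T.obj X ⟶ T.obj X) (n : ℕ) :
    T.iterate f n ≤ T.iterate f (n + 1) := by
  induction n with
  | zero => exact T.isBot_bot X _
  | succ n ih =>
    exact (OmegaCPOEnriched.comp_continuous _ _ _).monotone
      (show (T.iterate f n, f) ≤ (T.iterate f (n + 1), f) from ⟨ih, le_refl f⟩)

/-- The uniform fixed point operator `f† = sup_n fⁿ ∘ ⊥ : 1 ⟶ X_⊥` for `f : X_⊥ ⟶ X_⊥`. -/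
def lfp (T : LiftingMonad C) {X : C} (f : T.obj X ⟶ T.obj X) : 𝟙_ C ⟶ T.obj X :=
  OmegaCompletePartialOrder.ωSup
    (⟨T.iterate f, monotone_nat_of_le_succ (T.iterate_le_succ f)⟩ :
      OmegaCompletePartialOrder.Chain (𝟙_ C ⟶ T.obj X))

/-- The parameterised extension of the uniform fixed point operator to Eilenberg-Moore algebras
`ν : A_⊥ ⟶ A`. A morphism `f : I × A ⟶ A` is turned into the endomorphism
`η ∘ Λ(f ∘ ⟨π₁, Λ⁻¹(ν')⟩)` of `(I ⇒ A)_⊥`, where `ν' : (I ⇒ A)_⊥ ⟶ (I ⇒ A)` is the induced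
structure map; `f† : I ⟶ A` is the uncurrying of the image under `ν'` of its fixed point. -/
def Strength.dagger {I A : C} (ν : T.obj A ⟶ A) (f : I ⊗ A ⟶ A) : I ⟶ A :=
  lift (𝟙 I) (toUnit I ≫ T.lfp
      (curry (lift (fst I (T.obj ((ihom I).obj A))) (uncurry (str.algExp I ν)) ≫ f) ≫
        T.unit ((ihom I).obj A))) ≫
    uncurry (str.algExp I ν)

end LiftingMonad

/-- Interpretation of simple types. -/
def Ty.interp {B : Type a} (base : B → C) (Ω : C) : Ty B → C
  | .prop => Ω
  | .base t => base t
  | .unit => 𝟙_ C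
  | .prod σ τ => Ty.interp base Ω σ ⊗ Ty.interp base Ω τ
  | .empty => zero
  | .sum σ τ => plus (Ty.interp base Ω σ) (Ty.interp base Ω τ)
  | .arr σ => (ihom (Ty.interp base Ω σ)).obj Ω

/-- A `λ_HFL`-model on the `ω`CPO-enriched bicartesian closed category `C`. -/
structure Model (S : Signature.{a, b, c}) (C : Type u) [Category.{v} C]
    [CartesianMonoidalCategory C] [MonoidalClosed C] [FiniteCoproducts C]
    [OmegaCPOEnriched C] where
  T : LiftingMonad C
  str : T.Strength
  base : S.Base → C
  Ω : C
  botΩ : 𝟙_ C ⟶ Ω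
  isBot_botΩ : IsBot botΩ
  op : ∀ o : S.BO, Ty.interp base Ω (S.ar o) ⟶ Ty.interp base Ω (S.car o)

namespace Model

variable {S : Signature.{a, b, c}} (𝒜 : Model S C)

/-- Interpretation of simple types. -/
abbrev ty (σ : Ty S.Base) : C := σ.interp 𝒜.base 𝒜.Ω

/-- Interpretation of simple contexts. -/
def ctx : Ctx S → C
  | [] => 𝟙_ C
  | σ :: Γ => ctx Γ ⊗ 𝒜.ty σ

/-- Interpretation of variables. -/
def var : {Γ : Ctx S} → {σ : Ty S.Base} → Var Γ σ → (𝒜.ctx Γ ⟶ 𝒜.ty σ)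
  | _, _, .zero => snd _ _
  | _, _, .succ x => fst _ _ ≫ var x

/-- Interpretation of terms. -/
def tm : {Γ : Ctx S} → {σ : Ty S.Base} → Tm S Γ σ → (𝒜.ctx Γ ⟶ 𝒜.ty σ)
  | _, _, .var x => 𝒜.var x
  | _, _, .op o M => tm M ≫ 𝒜.op o
  | _, _, .unit => toUnit _
  | _, _, .pair M N => lift (tm M) (tm N)
  | _, _, .fst M => tm M ≫ fst _ _
  | _, _, .snd M => tm M ≫ snd _ _
  | _, _, .caseEmpty M => tm M ≫ initialTo _
  | _, _, .inl M => tm M ≫ inl _ _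
  | _, _, .inr M => tm M ≫ inr _ _
  | Γ, _, .caseSum (σ₁ := σ₁) (σ₂ := σ₂) M N₁ N₂ =>
      lift (𝟙 (𝒜.ctx Γ)) (tm M) ≫ distribInv (𝒜.ctx Γ) (𝒜.ty σ₁) (𝒜.ty σ₂) ≫
        desc (tm N₁) (tm N₂)
  | Γ, _, .lam (σ := σ) M =>
      curry (lift (snd (𝒜.ty σ) (𝒜.ctx Γ)) (fst (𝒜.ty σ) (𝒜.ctx Γ)) ≫ tm M)
  | _, _, .app (σ := σ) M N => lift (tm N) (tm M) ≫ (ihom.ev (𝒜.ty σ)).app 𝒜.Ω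
  | _, _, .fix (σ := σ) M =>
      𝒜.str.dagger (𝒜.str.algExp (𝒜.ty σ) (𝒜.T.algOfBot 𝒜.botΩ 𝒜.isBot_botΩ)) (tm M)

/-- Predicates on an object: sets of global elements. -/
abbrev _root_.HFL.Pred (X : C) : Type v := Set (𝟙_ C ⟶ X)

/-- An interpretation of the atomic predicates of the signature. -/
def PredInterp : Type (max c v) := ∀ p : S.AP, Pred (𝒜.ty (S.arAP p))

variable {𝒜} (ℐ : 𝒜.PredInterp)

/-- Interpretation of all atomic predicates; `≤_Prop` and `=_b` have their fixed meaning. -/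
def atom : (p : Atom S) → Pred (𝒜.ty p.arity)
  | .leProp => {z : 𝟙_ C ⟶ 𝒜.Ω ⊗ 𝒜.Ω | z ≫ fst _ _ ≤ z ≫ snd _ _}
  | .eqBase t => {z : 𝟙_ C ⟶ 𝒜.base t ⊗ 𝒜.base t | z ≫ fst _ _ = z ≫ snd _ _}
  | .ap p => ℐ p

/-- Interpretation of formulas. -/
def form {Γ : Ctx S} : Form S Γ → Pred (𝒜.ctx Γ)
  | .atom p M => {γ | γ ≫ 𝒜.tm M ∈ atom ℐ p}
  | .top => Set.univ
  | .bot => ∅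
  | .imp φ ψ => {γ | γ ∈ form φ → γ ∈ form ψ}
  | .and φ ψ => form φ ∩ form ψ
  | .or φ ψ => form φ ∪ form ψ

/-- Interpretation of refinement types. For a predicate `P` on the context (the interpretation of
the refinement context), `rty ℐ P A` is the last component of the interpretation
`((⟦Γ⟧, ⟦σ⟧), P, rty ℐ P A)` of `A`. -/
def rty : {Γ : Ctx S} → {σ : Ty S.Base} → Pred (𝒜.ctx Γ) → RTy S Γ σ → Pred (𝒜.ctx (σ :: Γ))
  | Γ, _, P, .refine σ _ φ =>
      {p : 𝟙_ C ⟶ 𝒜.ctx Γ ⊗ 𝒜.ty σ | p ≫ fst _ _ ∈ P ∧ p ∈ form ℐ φ}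
  | Γ, _, P, .sigma (σ := σ) (τ := τ) A B =>
      {p : 𝟙_ C ⟶ 𝒜.ctx Γ ⊗ (𝒜.ty σ ⊗ 𝒜.ty τ) |
        p ≫ (α_ (𝒜.ctx Γ) (𝒜.ty σ) (𝒜.ty τ)).inv ∈ rty (rty P A) B}
  | _, _, _, .empty => ∅
  | Γ, _, P, .sum (σ₁ := σ₁) (σ₂ := σ₂) A₁ A₂ =>
      ((fun f : 𝟙_ C ⟶ 𝒜.ctx Γ ⊗ 𝒜.ty σ₁ => f ≫ 𝒜.ctx Γ ◁ inl (𝒜.ty σ₁) (𝒜.ty σ₂)) '' rty P A₁) ∪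
      ((fun f : 𝟙_ C ⟶ 𝒜.ctx Γ ⊗ 𝒜.ty σ₂ => f ≫ 𝒜.ctx Γ ◁ inr (𝒜.ty σ₁) (𝒜.ty σ₂)) '' rty P A₂)
  | Γ, _, P, .pi (σ := σ) A φ =>
      {p : 𝟙_ C ⟶ 𝒜.ctx Γ ⊗ (ihom (𝒜.ty σ)).obj 𝒜.Ω | p ≫ fst _ _ ∈ P ∧
        ∀ x : 𝟙_ C ⟶ 𝒜.ty σ, lift (p ≫ fst _ _) x ∈ rty P A →
          lift (lift (p ≫ fst _ _) x) (lift x (p ≫ snd _ _) ≫ (ihom.ev (𝒜.ty σ)).app 𝒜.Ω) ∈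
            {q : 𝟙_ C ⟶ (𝒜.ctx Γ ⊗ 𝒜.ty σ) ⊗ 𝒜.Ω | q ≫ fst _ _ ∈ rty P A ∧ q ∈ form ℐ φ}}

/-- Interpretation of refinement contexts (the predicate part). -/
def rctx : {Γ : Ctx S} → RCtx S Γ → Pred (𝒜.ctx Γ)
  | _, .nil => Set.univ
  | _, .snoc G A => rty ℐ (rctx G) A

variable (𝒜) in
/-- `γ[x ↦ f]`. -/
def update : {Γ : Ctx S} → {σ : Ty S.Base} →
    (𝟙_ C ⟶ 𝒜.ctx Γ) → Var Γ σ → (𝟙_ C ⟶ 𝒜.ty σ) → (𝟙_ C ⟶ 𝒜.ctx Γ)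
  | _, _, γ, .zero, f => lift (γ ≫ fst _ _) f
  | _, _, γ, .succ x, f => lift (update (γ ≫ fst _ _) x f) (γ ≫ snd _ _)

variable (𝒜) in
/-- Admissibility of a predicate on `⟦Γ⟧` at a variable of type `Prop`. -/
def Admissible {Γ : Ctx S} (Q : Pred (𝒜.ctx Γ)) (x : Var Γ (.prop : Ty S.Base)) : Prop :=
  (∀ γ : 𝟙_ C ⟶ 𝒜.ctx Γ, 𝒜.update γ x 𝒜.botΩ ∈ Q) ∧
  ∀ (γ : 𝟙_ C ⟶ 𝒜.ctx Γ) (f : OmegaCompletePartialOrder.Chain (𝟙_ C ⟶ 𝒜.Ω)),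
    (∀ k, 𝒜.update γ x (f k) ∈ Q) → 𝒜.update γ x (OmegaCompletePartialOrder.ωSup f) ∈ Q

/-! ## Subtyping and typing -/

/-- `Entails ℐ G φ ψ`: whenever `G` and `φ` hold, so does `ψ`. -/
def Entails {Γ : Ctx S} {σ : Ty S.Base} (G : RCtx S Γ) (φ ψ : Form S (σ :: Γ)) : Prop :=
  ∀ p : 𝟙_ C ⟶ 𝒜.ctx Γ ⊗ 𝒜.ty σ, p ≫ fst _ _ ∈ rctx ℐ G → p ∈ form ℐ φ → p ∈ form ℐ ψ

/-- The subtyping relation `G ⊢ A <: B`. -/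
inductive SubTy : {Γ : Ctx S} → {σ : Ty S.Base} → RCtx S Γ → RTy S Γ σ → RTy S Γ σ → Prop
  | refl {Γ : Ctx S} {σ : Ty S.Base} (G : RCtx S Γ) (A : RTy S Γ σ) : SubTy G A A
  | trans {Γ : Ctx S} {σ : Ty S.Base} {G : RCtx S Γ} {A₁ A₂ A₃ : RTy S Γ σ} :
      SubTy G A₁ A₂ → SubTy G A₂ A₃ → SubTy G A₁ A₃
  | refine {Γ : Ctx S} {σ : Ty S.Base} {G : RCtx S Γ} (hσ : σ.IsGround)
      {φ ψ : Form S (σ :: Γ)} : Entails ℐ G φ ψ → SubTy G (.refine σ hσ φ) (.refine σ hσ ψ)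
  | pi {Γ : Ctx S} {σ : Ty S.Base} {G : RCtx S Γ} {A₁ A₂ : RTy S Γ σ}
      {φ₁ φ₂ : Form S (.prop :: σ :: Γ)} :
      SubTy G A₂ A₁ → SubTy (G.snoc A₂) (.prop φ₁) (.prop φ₂) →
      SubTy G (.pi A₁ φ₁) (.pi A₂ φ₂)
  | sigma {Γ : Ctx S} {σ τ : Ty S.Base} {G : RCtx S Γ} {A₁ A₂ : RTy S Γ σ}
      {B₁ B₂ : RTy S (σ :: Γ) τ} :
      SubTy G A₁ A₂ → SubTy (G.snoc A₁) B₁ B₂ → SubTy G (.sigma A₁ B₁) (.sigma A₂ B₂)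
  | sum {Γ : Ctx S} {σ τ : Ty S.Base} {G : RCtx S Γ} {A₁ A₂ : RTy S Γ σ} {B₁ B₂ : RTy S Γ τ} :
      SubTy G A₁ A₂ → SubTy G B₁ B₂ → SubTy G (.sum A₁ B₁) (.sum A₂ B₂)

/-- The dependent refinement typing judgement `G ⊢ M : A`. -/
inductive HasType : {Γ : Ctx S} → {σ : Ty S.Base} → RCtx S Γ → Tm S Γ σ → RTy S Γ σ → Prop
  | sub {Γ : Ctx S} {σ : Ty S.Base} {G : RCtx S Γ} {M : Tm S Γ σ} {A B : RTy S Γ σ} :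
      HasType G M A → SubTy ℐ G A B → HasType G M B
  | app {Γ : Ctx S} {σ : Ty S.Base} {G : RCtx S Γ} {M : Tm S Γ (.arr σ)} {N : Tm S Γ σ}
      {A : RTy S Γ σ} {φ : Form S (.prop :: σ :: Γ)} :
      HasType G M (.pi A φ) → HasType G N A → HasType G (.app M N) ((RTy.prop φ).inst N)
  | lam {Γ : Ctx S} {σ : Ty S.Base} {G : RCtx S Γ} {A : RTy S Γ σ} {M : Tm S (σ :: Γ) .prop}
      {φ : Form S (.prop :: σ :: Γ)} :
      HasType (G.snoc A) M (.prop φ) → HasType G (.lam M) (.pi A φ)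
  | unit {Γ : Ctx S} (G : RCtx S Γ) : HasType G .unit (.refine .unit trivial .top)
  | pair {Γ : Ctx S} {σ τ : Ty S.Base} {G : RCtx S Γ} {M : Tm S Γ σ} {N : Tm S Γ τ}
      {A : RTy S Γ σ} {B : RTy S (σ :: Γ) τ} :
      HasType G M A → HasType G N (B.inst M) → HasType G (.pair M N) (.sigma A B)
  | fst {Γ : Ctx S} {σ τ : Ty S.Base} {G : RCtx S Γ} {M : Tm S Γ (.prod σ τ)}
      {A : RTy S Γ σ} {B : RTy S (σ :: Γ) τ} :
      HasType G M (.sigma A B) → HasType G (.fst M) A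
  | snd {Γ : Ctx S} {σ τ : Ty S.Base} {G : RCtx S Γ} {M : Tm S Γ (.prod σ τ)}
      {A : RTy S Γ σ} {B : RTy S (σ :: Γ) τ} :
      HasType G M (.sigma A B) → HasType G (.snd M) (B.inst (.fst M))
  | caseEmpty {Γ : Ctx S} {τ : Ty S.Base} {G : RCtx S Γ} {M : Tm S Γ .empty} (B : RTy S Γ τ) :
      HasType G M .empty → HasType G (.caseEmpty M) B
  | inl {Γ : Ctx S} {σ₁ σ₂ : Ty S.Base} {G : RCtx S Γ} {M : Tm S Γ σ₁} {A₁ : RTy S Γ σ₁}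
      (A₂ : RTy S Γ σ₂) : HasType G M A₁ → HasType G (.inl M) (.sum A₁ A₂)
  | inr {Γ : Ctx S} {σ₁ σ₂ : Ty S.Base} {G : RCtx S Γ} {M : Tm S Γ σ₂} (A₁ : RTy S Γ σ₁)
      {A₂ : RTy S Γ σ₂} : HasType G M A₂ → HasType G (.inr M) (.sum A₁ A₂)
  | caseSum {Γ : Ctx S} {σ₁ σ₂ τ : Ty S.Base} {G : RCtx S Γ} {M : Tm S Γ (.sum σ₁ σ₂)}
      {N₁ : Tm S (σ₁ :: Γ) τ} {N₂ : Tm S (σ₂ :: Γ) τ} {A₁ : RTy S Γ σ₁} {A₂ : RTy S Γ σ₂}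
      {B : RTy S (.sum σ₁ σ₂ :: Γ) τ} :
      HasType G M (.sum A₁ A₂) →
      HasType (G.snoc A₁) N₁ (B.subst (Subst.replace (.inl (.var .zero)))) →
      HasType (G.snoc A₂) N₂ (B.subst (Subst.replace (.inr (.var .zero)))) →
      HasType G (.caseSum M N₁ N₂) (B.inst M)
  | varRefine {Γ : Ctx S} {t : S.Base} {G : RCtx S Γ} {x : Var Γ (.base t : Ty S.Base)}
      {φ : Form S (.base t :: Γ)} : G.lookup x = .base t φ →
      HasType G (.var x)
        (.base t (.atom (.eqBase t) (.pair (.var .zero) (.var (.succ x)))))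
  | var {Γ : Ctx S} {σ : Ty S.Base} (G : RCtx S Γ) (x : Var Γ σ) :
      HasType G (.var x) (G.lookup x)
  | fix {Γ : Ctx S} {σ : Ty S.Base} {G : RCtx S Γ} {A : RTy S Γ σ}
      {φ : Form S (.prop :: σ :: Γ)} {M : Tm S (.arr σ :: Γ) (.arr σ)} :
      HasType (G.snoc (.pi A φ)) M (RTy.pi A φ).wk →
      𝒜.Admissible (form ℐ φ) .zero →
      HasType G (.fix M) (.pi A φ)
  | op {Γ : Ctx S} {G : RCtx S Γ} (o : S.BO) {M : Tm S Γ (S.ar o)} {A : RTy S Γ (S.ar o)}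
      {B : RTy S Γ (S.car o)} :
      HasType G M A →
      (∀ p : 𝟙_ C ⟶ 𝒜.ctx Γ ⊗ 𝒜.ty (S.ar o), p ∈ rctx ℐ (G.snoc A) →
        p ≫ 𝒜.ctx Γ ◁ 𝒜.op o ∈ rctx ℐ (G.snoc B)) →
      HasType G (.op o M) B

end Model

end Models

end HFL

end

/-!
The proof is an induction on the typing derivation, for the statement "every environment `γ`
satisfying the context is sent by `M` to a `y` such that the pair of `γ` and `y` satisfies the
type". Two things carry it.

*Fixed points.* The operator `f†` is defined through the endomorphism of `(I ⇒ A)_⊥` associated with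
`f`, but it is simply the supremum of the Kleene approximants `I ⟶ A` that start at the constant
bottom of `A` and iterate `a ↦ f ∘ ⟨id, a⟩` (`LiftingMonad.Strength.dagger_spec`). The only point
that needs an argument is the first approximant: the strength preserves bottom
(`LiftingMonad.Strength.bot_st`). No such axiom is assumed, but the bottom of `X_⊥` is the image of
that of `0_⊥`, naturality of the strength reduces the claim to `I × 0_⊥ ⟶ (I × 0)_⊥`, and
`(I × 0)_⊥ ≅ 0_⊥` is terminal. Two consequences are used: `f†` is natural in the parameter `I`
(`comp_dagger`), and Scott induction holds for it (`comp_dagger_mem`).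

*Substitution.* Since `f†` is natural, a syntactic substitution is interpreted by precomposition with
a morphism between contexts (`Model.tm_subst`). Substitution in a refinement type then becomes
inverse image along this morphism (`Model.rty_subst`). Together with the fact that a refinement type
depends on the predicate on its context only by restriction to it (`Model.mem_rty_iff`), this gives
the meaning of `A[M/x]`, of weakened types and of `B[ι x/z]`, and also monotonicity of dependent
pair types in the context, as needed for subtyping.

Given these, each typing rule is a computation with `⟨γ, y⟩`. The rule for `fix` is Scott induction:
admissibility of the postcondition provides the base case and the closure under suprema, evaluation
being continuous.
-/

namespace HFL

open FiniteCoproducts OmegaCompletePartialOrder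

/-! ### Bicartesian closed structure and precomposition -/

section Cartesian

variable {C : Type u} [Category.{v} C] [CartesianMonoidalCategory C]

/-- The Kleene approximants of the parameterised fixed point of `f`, starting at the constant
morphism with value `x`. The starting point need not be least in `I ⟶ A`, so monotonicity is not
automatic; see `LiftingMonad.Strength.dagger_spec`. -/
def approx {I A : C} (x : 𝟙_ C ⟶ A) (f : I ⊗ A ⟶ A) : ℕ → (I ⟶ A)
  | 0 => toUnit I ≫ x
  | n + 1 => lift (𝟙 I) (approx x f n) ≫ f

theorem comp_approx {I J A : C} (g : J ⟶ I) (x : 𝟙_ C ⟶ A) (f : I ⊗ A ⟶ A) (n : ℕ) :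
    g ≫ approx x f n = approx x (g ▷ A ≫ f) n := by
  induction n with
  | zero => simp [approx]
  | succ n ih => rw [approx, approx, ← ih, comp_lift_assoc]; simp

variable [MonoidalClosed C]

theorem lift_comp_ev {I X Y Z : C} (g : Z ⟶ I) (z : Z ⟶ X) (h : X ⟶ (ihom I).obj Y) :
    lift g (z ≫ h) ≫ (ihom.ev I).app Y = lift g z ≫ uncurry h := by
  have hw : lift g (z ≫ h) = lift g z ≫ I ◁ h := by simp
  rw [hw, Category.assoc, ← uncurry_eq]

/-- The `β`-rule. In `I ⊗ X` the bound variable is on the right while `curry` abstracts the left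
factor, whence the swap, as in the interpretation of `Tm.lam`. -/
theorem lift_comp_curry_swap_ev {I X Y Z : C} (g : Z ⟶ I) (x : Z ⟶ X) (f : I ⊗ X ⟶ Y) :
    lift x (g ≫ curry (lift (snd X I) (fst X I) ≫ f)) ≫ (ihom.ev X).app Y = lift g x ≫ f := by
  rw [lift_comp_ev, uncurry_curry, comp_lift_assoc, lift_fst, lift_snd]

theorem comp_curry_swap {I J X Y : C} (g : J ⟶ I) (f : I ⊗ X ⟶ Y) :
    g ≫ curry (lift (snd X I) (fst X I) ≫ f) =
      curry (lift (snd X J) (fst X J) ≫ g ▷ X ≫ f) := by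
  rw [← curry_natural_left, ← Category.assoc, ← Category.assoc]
  congr 2
  ext <;> simp

end Cartesian

section Category

variable {C : Type u} [Category.{v} C] [CartesianMonoidalCategory C]
  [MonoidalClosed C] [FiniteCoproducts C]

theorem inl_distribInv {I X Y Z : C} (g : Z ⟶ I) (x : Z ⟶ X) :
    lift g (x ≫ inl X Y) ≫ distribInv I X Y = lift g x ≫ inl (I ⊗ X) (I ⊗ Y) := by
  have h : lift g (x ≫ inl X Y) = lift g x ≫ I ◁ inl X Y := by simp
  rw [distribInv, IsIso.comp_inv_eq, Category.assoc, distrib, inl_desc, h]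

theorem inr_distribInv {I X Y Z : C} (g : Z ⟶ I) (y : Z ⟶ Y) :
    lift g (y ≫ inr X Y) ≫ distribInv I X Y = lift g y ≫ inr (I ⊗ X) (I ⊗ Y) := by
  have h : lift g (y ≫ inr X Y) = lift g y ≫ I ◁ inr X Y := by simp
  rw [distribInv, IsIso.comp_inv_eq, Category.assoc, distrib, inr_desc, h]

theorem whiskerRight_distribInv_desc {I J X Y Z : C} (g : I ⟶ J) (f₁ : J ⊗ X ⟶ Z)
    (f₂ : J ⊗ Y ⟶ Z) :
    g ▷ plus X Y ≫ distribInv J X Y ≫ desc f₁ f₂ =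
      distribInv I X Y ≫ desc (g ▷ X ≫ f₁) (g ▷ Y ≫ f₂) := by
  have key : distrib I X Y ≫ g ▷ plus X Y ≫ distribInv J X Y =
      desc (g ▷ X ≫ inl _ _) (g ▷ Y ≫ inr _ _) := by
    rw [distribInv, ← Category.assoc, IsIso.comp_inv_eq]
    apply FiniteCoproducts.hom_ext
    · rw [distrib, distrib, ← Category.assoc, inl_desc, ← Category.assoc, inl_desc,
        Category.assoc, inl_desc, whisker_exchange]
    · rw [distrib, distrib, ← Category.assoc, inr_desc, ← Category.assoc, inr_desc,
        Category.assoc, inr_desc, whisker_exchange]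
  rw [← cancel_epi (distrib I X Y), ← Category.assoc (g ▷ _), ← Category.assoc, key]
  simp only [distribInv, IsIso.hom_inv_id_assoc]
  apply FiniteCoproducts.hom_ext
  · rw [← Category.assoc, inl_desc, Category.assoc, inl_desc, inl_desc]
  · rw [← Category.assoc, inr_desc, Category.assoc, inr_desc, inr_desc]

/-- Naturality of case analysis on a sum in the context. -/
theorem comp_case {I J X Y Z : C} (g : J ⟶ I) (m : I ⟶ plus X Y) (f₁ : I ⊗ X ⟶ Z)
    (f₂ : I ⊗ Y ⟶ Z) :
    g ≫ lift (𝟙 I) m ≫ distribInv I X Y ≫ desc f₁ f₂ =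
      lift (𝟙 J) (g ≫ m) ≫ distribInv J X Y ≫ desc (g ▷ X ≫ f₁) (g ▷ Y ≫ f₂) := by
  rw [← whiskerRight_distribInv_desc, comp_lift_assoc]
  simp

theorem comp_case_of_inl {I X Y Z W : C} {g : W ⟶ I} {m : I ⟶ plus X Y} {x : W ⟶ X}
    (h : x ≫ inl X Y = g ≫ m) (f₁ : I ⊗ X ⟶ Z) (f₂ : I ⊗ Y ⟶ Z) :
    g ≫ lift (𝟙 I) m ≫ distribInv I X Y ≫ desc f₁ f₂ = lift g x ≫ f₁ := by
  rw [comp_lift_assoc, Category.comp_id, ← h, ← Category.assoc, inl_distribInv, Category.assoc,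
    inl_desc]

theorem comp_case_of_inr {I X Y Z W : C} {g : W ⟶ I} {m : I ⟶ plus X Y} {y : W ⟶ Y}
    (h : y ≫ inr X Y = g ≫ m) (f₁ : I ⊗ X ⟶ Z) (f₂ : I ⊗ Y ⟶ Z) :
    g ≫ lift (𝟙 I) m ≫ distribInv I X Y ≫ desc f₁ f₂ = lift g y ≫ f₂ := by
  rw [comp_lift_assoc, Category.comp_id, ← h, ← Category.assoc, inr_distribInv, Category.assoc,
    inr_desc]

end Category

/-! ### The parameterised fixed point operator -/

section Fixpoint

variable {C : Type u} [Category.{v} C] [CartesianMonoidalCategory C]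
  [MonoidalClosed C] [FiniteCoproducts C] [OmegaCPOEnriched C]

theorem prodMk_left_continuous {α β : Type*} [OmegaCompletePartialOrder α]
    [OmegaCompletePartialOrder β] (x : α) : ωScottContinuous (fun y : β => (x, y)) :=
  (ScottContinuous.prodMk (f := Function.const β x) (g := id) (ScottContinuous.const x)
    ScottContinuous.id).scottContinuousOn

theorem prodMk_right_continuous {α β : Type*} [OmegaCompletePartialOrder α]
    [OmegaCompletePartialOrder β] (y : β) : ωScottContinuous (fun x : α => (x, y)) :=
  (ScottContinuous.prodMk (f := id) (g := Function.const α y) ScottContinuous.id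
    (ScottContinuous.const y)).scottContinuousOn

theorem comp_left_continuous {X Y Z : C} (g : X ⟶ Y) :
    ωScottContinuous (fun f : Y ⟶ Z => g ≫ f) :=
  (OmegaCPOEnriched.comp_continuous X Y Z).comp (prodMk_left_continuous g)

theorem comp_right_continuous {X Y Z : C} (g : Y ⟶ Z) :
    ωScottContinuous (fun f : X ⟶ Y => f ≫ g) :=
  (OmegaCPOEnriched.comp_continuous X Y Z).comp (prodMk_right_continuous g)

theorem lift_right_continuous {X Y Z : C} (g : X ⟶ Y) :
    ωScottContinuous (fun f : X ⟶ Z => lift g f) :=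
  (OmegaCPOEnriched.lift_continuous X Y Z).comp (prodMk_left_continuous g)

theorem isLUB_image_seq {α β : Type*} [OmegaCompletePartialOrder α]
    [OmegaCompletePartialOrder β] {F : α → β} (hF : ωScottContinuous F) {d : ℕ → α}
    (hd : Monotone d) {x : α} (hx : IsLUB (Set.range d) x) :
    IsLUB (Set.range fun n => F (d n)) (F x) := by
  have hsup : x = ωSup (⟨d, hd⟩ : Chain α) := hx.unique (isLUB_range_ωSup (α := α) ⟨d, hd⟩)
  rw [hsup, hF.map_ωSup]
  exact isLUB_range_ωSup (Chain.map (⟨d, hd⟩ : Chain α) ⟨F, hF.monotone⟩)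

namespace LiftingMonad

variable {T : LiftingMonad C}

theorem hom_ext {X A : C} {x : 𝟙_ C ⟶ A} (hx : IsBot x) {g h : T.obj X ⟶ A}
    (hu : T.unit X ≫ g = T.unit X ≫ h) (hg : T.bot X ≫ g = x) (hh : T.bot X ≫ h = x) : g = h :=
  (T.existsUnique_ext x hx (T.unit X ≫ h)).unique ⟨hu, hg⟩ ⟨rfl, hh⟩

theorem unit_map {X Y : C} (f : X ⟶ Y) : T.unit X ≫ T.map f = f ≫ T.unit Y :=
  T.unit_ext _ _ _

theorem bot_map {X Y : C} (f : X ⟶ Y) : T.bot X ≫ T.map f = T.bot Y :=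
  T.bot_ext _ _ _

/-- The lifting of an initial object is terminal: the identity and the constant `⊥` are both
homomorphisms extending the unique morphism out of `X`. -/
theorem eq_toUnit_comp_bot {X Z : C} (hX : Limits.IsInitial X) (f : Z ⟶ T.obj X) :
    f = toUnit Z ≫ T.bot X := by
  have h : 𝟙 (T.obj X) = toUnit _ ≫ T.bot X :=
    hom_ext (T.isBot_bot X) (hX.hom_ext _ _) (Category.comp_id _) (by
      rw [← Category.assoc, toUnit_unique (T.bot X ≫ toUnit _) (𝟙 _), Category.id_comp])
  rw [← Category.comp_id f, h, ← Category.assoc, toUnit_unique (f ≫ toUnit _) (toUnit Z)]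

/-- A product with the initial object is initial, by cartesian closure. -/
def isInitialTensor (I : C) : Limits.IsInitial (I ⊗ zero (C := C)) :=
  Limits.IsInitial.ofUniqueHom (fun X => uncurry (initialTo ((ihom I).obj X)))
    fun _ _ => curry_injective (isInitial.hom_ext _ _)

/-- A strength preserves bottom. By naturality it suffices to treat `X = 0`, where the codomain
`(I × 0)_⊥` is terminal. -/
theorem Strength.bot_st (str : T.Strength) {I X Z : C} (g : Z ⟶ I) :
    lift g (toUnit Z ≫ T.bot X) ≫ str.st I X = toUnit Z ≫ T.bot (I ⊗ X) := by
  have h : lift g (toUnit Z ≫ T.bot X) =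
      lift g (toUnit Z ≫ T.bot zero) ≫ (𝟙 I ⊗ₘ T.map (initialTo X)) := by
    simp [bot_map]
  rw [h, Category.assoc, str.naturality, ← Category.assoc,
    eq_toUnit_comp_bot (isInitialTensor I) (lift g _ ≫ _), Category.assoc, bot_map]

theorem Strength.unit_uncurry_algExp (str : T.Strength) (X : C) {A : C} {ν : T.obj A ⟶ A}
    (hν : T.unit A ≫ ν = 𝟙 A) :
    X ◁ T.unit _ ≫ uncurry (str.algExp X ν) = (ihom.ev X).app A := by
  rw [algExp, uncurry_curry, ← Category.assoc, str.unit_st, ← Category.assoc, unit_map,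
    Category.assoc]
  exact (congrArg _ hν).trans (Category.comp_id _)

theorem Strength.bot_uncurry_algExp (str : T.Strength) {X A Z : C} (ν : T.obj A ⟶ A)
    (g : Z ⟶ X) :
    lift g (toUnit Z ≫ T.bot _) ≫ uncurry (str.algExp X ν) = toUnit Z ≫ T.bot A ≫ ν := by
  rw [algExp, uncurry_curry, ← Category.assoc, str.bot_st, Category.assoc,
    ← Category.assoc (T.bot _), bot_map]
  rfl

theorem Strength.bot_algExp_ev (str : T.Strength) {X A : C} (ν : T.obj A ⟶ A)
    (x : 𝟙_ C ⟶ X) :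
    lift x (T.bot _ ≫ str.algExp X ν) ≫ (ihom.ev X).app A = T.bot A ≫ ν := by
  have h := str.bot_uncurry_algExp ν x
  rw [toUnit_unique (toUnit (𝟙_ C)) (𝟙 _), Category.id_comp, Category.id_comp] at h
  rw [lift_comp_ev, h]

theorem Strength.unit_algExp (str : T.Strength) (X : C) {A : C} {ν : T.obj A ⟶ A}
    (hν : T.unit A ≫ ν = 𝟙 A) : T.unit _ ≫ str.algExp X ν = 𝟙 _ := by
  apply uncurry_injective
  rw [uncurry_natural_left, str.unit_uncurry_algExp X hν, uncurry_id_eq_ev]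

/-- The parameterised fixed point is the supremum of the increasing sequence of Kleene
approximants: the `n`-th iterate in `(I ⇒ A)_⊥` that defines it is sent to the `n`-th approximant by
the uncurried structure map. -/
theorem Strength.dagger_spec (str : T.Strength) {I A : C} {ν : T.obj A ⟶ A}
    (hν : T.unit A ≫ ν = 𝟙 A) (f : I ⊗ A ⟶ A) :
    Monotone (approx (T.bot A ≫ ν) f) ∧
      IsLUB (Set.range (approx (T.bot A ≫ ν) f)) (str.dagger ν f) := by
  set k := curry (lift (fst I (T.obj ((ihom I).obj A))) (uncurry (str.algExp I ν)) ≫ f) with hk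
  have hmono : Monotone (T.iterate (k ≫ T.unit _)) := monotone_nat_of_le_succ (T.iterate_le_succ _)
  have hF : ωScottContinuous (fun z : 𝟙_ C ⟶ T.obj ((ihom I).obj A) =>
      lift (𝟙 I) (toUnit I ≫ z) ≫ uncurry (str.algExp I ν)) :=
    (comp_right_continuous _).comp ((lift_right_continuous _).comp (comp_left_continuous _))
  have happrox : approx (T.bot A ≫ ν) f = fun n =>
      lift (𝟙 I) (toUnit I ≫ T.iterate (k ≫ T.unit _) n) ≫ uncurry (str.algExp I ν) := by
    funext n
    induction n with
    | zero => exact (str.bot_uncurry_algExp ν (𝟙 I)).symm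
    | succ n ih =>
      have h : lift (𝟙 I) (toUnit I ≫ T.iterate (k ≫ T.unit _) (n + 1)) =
          lift (𝟙 I) ((toUnit I ≫ T.iterate (k ≫ T.unit _) n) ≫ k) ≫ I ◁ T.unit _ := by
        simp [iterate]
      rw [h, Category.assoc, str.unit_uncurry_algExp I hν, hk, lift_comp_ev, uncurry_curry, ← hk,
        approx, ih, ← Category.assoc, comp_lift, lift_fst]
  rw [happrox]
  exact ⟨hF.monotone.comp hmono, isLUB_image_seq hF hmono (isLUB_range_ωSup ⟨_, hmono⟩)⟩

/-- Naturality of the parameterised fixed point in the parameter. -/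
theorem Strength.comp_dagger (str : T.Strength) {I J A : C} {ν : T.obj A ⟶ A}
    (hν : T.unit A ≫ ν = 𝟙 A) (g : J ⟶ I) (f : I ⊗ A ⟶ A) :
    g ≫ str.dagger ν f = str.dagger ν (g ▷ A ≫ f) := by
  have h := isLUB_image_seq (comp_left_continuous g) (str.dagger_spec hν f).1
    (str.dagger_spec hν f).2
  simp only [comp_approx] at h
  exact h.unique (str.dagger_spec hν (g ▷ A ≫ f)).2

/-- Scott induction for the parameterised fixed point at a global element `γ` of the parameter. -/
theorem Strength.comp_dagger_mem (str : T.Strength) {I A : C} {ν : T.obj A ⟶ A}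
    (hν : T.unit A ≫ ν = 𝟙 A) {f : I ⊗ A ⟶ A} {γ : 𝟙_ C ⟶ I} {Q : Pred A}
    (hbot : T.bot A ≫ ν ∈ Q) (hstep : ∀ y ∈ Q, lift γ y ≫ f ∈ Q)
    (hsup : ∀ d : Chain (𝟙_ C ⟶ A), (∀ n, d n ∈ Q) → ωSup d ∈ Q) :
    γ ≫ str.dagger ν f ∈ Q := by
  obtain ⟨hmono, hlub⟩ := str.dagger_spec hν f
  have hcont := comp_left_continuous (Z := A) γ
  rw [(isLUB_image_seq hcont hmono hlub).unique
    (isLUB_range_ωSup ⟨_, hcont.monotone.comp hmono⟩)]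
  refine hsup _ fun n => ?_
  change γ ≫ approx (T.bot A ≫ ν) f n ∈ Q
  induction n with
  | zero =>
    rwa [approx, ← Category.assoc, toUnit_unique (γ ≫ toUnit I) (𝟙 _), Category.id_comp]
  | succ n ih =>
    rw [approx, comp_lift_assoc, Category.comp_id]
    exact hstep _ ih

end LiftingMonad

end Fixpoint

/-! ### Terms and substitution -/

namespace Model

variable {C : Type u} [Category.{v} C] [CartesianMonoidalCategory C]
  [MonoidalClosed C] [FiniteCoproducts C] [OmegaCPOEnriched C]
  {S : Signature.{a, b, c}} (𝒜 : Model S C)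

theorem ctx_hom_ext {X : C} {Γ : Ctx S} {f g : X ⟶ 𝒜.ctx Γ}
    (h : ∀ (σ : Ty S.Base) (x : Var Γ σ), f ≫ 𝒜.var x = g ≫ 𝒜.var x) : f = g := by
  induction Γ with
  | nil => exact toUnit_unique (X := X) f g
  | cons σ Γ ih =>
    refine CartesianMonoidalCategory.hom_ext (X := 𝒜.ctx Γ) (Y := 𝒜.ty σ) f g (ih fun τ x => ?_)
      (h σ .zero)
    exact (Category.assoc f _ _).trans ((h τ (.succ x)).trans (Category.assoc g _ _).symm)

/-- Interpretation of a substitution of terms over `Δ` for the variables of `Γ` as a morphism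
`⟦Δ⟧ ⟶ ⟦Γ⟧`. Renamings are interpreted through `Ren.toSubst`. -/
noncomputable def sub : {Γ Δ : Ctx S} → Subst Γ Δ → (𝒜.ctx Δ ⟶ 𝒜.ctx Γ)
  | [], _, _ => toUnit _
  | _ :: _, _, s => lift (sub fun _ x => s _ (.succ x)) (𝒜.tm (s _ .zero))

theorem sub_var {Γ Δ : Ctx S} (s : Subst Γ Δ) {σ : Ty S.Base} (x : Var Γ σ) :
    𝒜.sub s ≫ 𝒜.var x = 𝒜.tm (s σ x) := by
  induction x with
  | zero => exact lift_snd _ _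
  | succ x ih =>
    exact (Category.assoc _ _ _).symm.trans
      ((congrArg (· ≫ 𝒜.var x) (lift_fst _ _)).trans (ih _))

theorem sub_toSubst_up {Γ Δ : Ctx S} (r : Ren Γ Δ) (τ : Ty S.Base) :
    𝒜.sub (r.up τ).toSubst = 𝒜.sub r.toSubst ▷ 𝒜.ty τ := by
  refine 𝒜.ctx_hom_ext fun σ x => ?_
  rw [sub_var]
  cases x with
  | zero => exact (whiskerRight_snd _ _).symm
  | succ x =>
    rw [var]
    erw [whiskerRight_fst_assoc, sub_var]
    rfl

theorem tm_rename {Γ Δ : Ctx S} {σ : Ty S.Base} (r : Ren Γ Δ) (M : Tm S Γ σ) :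
    𝒜.tm (M.rename r) = 𝒜.sub r.toSubst ≫ 𝒜.tm M := by
  induction M generalizing Δ with
  | var x => exact (𝒜.sub_var r.toSubst x).symm
  | unit => exact toUnit_unique _ _
  | pair M N ih₁ ih₂ => simp only [Tm.rename, tm, ih₁, ih₂]; exact (comp_lift _ _ _).symm
  | caseSum M N₁ N₂ ih ih₁ ih₂ =>
    simp only [Tm.rename, tm, ih, ih₁, ih₂, sub_toSubst_up]
    exact (comp_case _ _ _ _).symm
  | lam M ih =>
    simp only [Tm.rename, tm, ih, sub_toSubst_up]
    exact (comp_curry_swap _ _).symm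
  | app M N ih₁ ih₂ =>
    simp only [Tm.rename, tm, ih₁, ih₂]
    exact (comp_lift_assoc _ _ _ _).symm
  | fix M ih =>
    simp only [Tm.rename, tm, ih, sub_toSubst_up]
    exact (LiftingMonad.Strength.comp_dagger _
      (LiftingMonad.Strength.unit_algExp _ _ (𝒜.T.unit_ext _ _ _)) _ _).symm
  | op _ _ ih | fst _ ih | snd _ ih | caseEmpty _ ih | inl _ ih | inr _ ih =>
    exact (congrArg (· ≫ _) (ih r)).trans (Category.assoc _ _ _)

theorem sub_wk {Γ : Ctx S} {τ : Ty S.Base} :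
    𝒜.sub (Ren.wk (Γ := Γ) (τ := τ)).toSubst = fst (𝒜.ctx Γ) (𝒜.ty τ) :=
  𝒜.ctx_hom_ext fun _ x => 𝒜.sub_var _ x

theorem sub_up {Γ Δ : Ctx S} (s : Subst Γ Δ) (τ : Ty S.Base) :
    𝒜.sub (s.up τ) = 𝒜.sub s ▷ 𝒜.ty τ := by
  refine 𝒜.ctx_hom_ext fun σ x => ?_
  rw [sub_var]
  cases x with
  | zero => exact (whiskerRight_snd _ _).symm
  | succ x =>
    rw [var]
    erw [whiskerRight_fst_assoc, sub_var]
    exact (𝒜.tm_rename _ _).trans (congrArg (· ≫ _) 𝒜.sub_wk)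

theorem tm_subst {Γ Δ : Ctx S} {σ : Ty S.Base} (s : Subst Γ Δ) (M : Tm S Γ σ) :
    𝒜.tm (M.subst s) = 𝒜.sub s ≫ 𝒜.tm M := by
  induction M generalizing Δ with
  | var x => exact (𝒜.sub_var s x).symm
  | unit => exact toUnit_unique _ _
  | pair M N ih₁ ih₂ => simp only [Tm.subst, tm, ih₁, ih₂]; exact (comp_lift _ _ _).symm
  | caseSum M N₁ N₂ ih ih₁ ih₂ =>
    simp only [Tm.subst, tm, ih, ih₁, ih₂, sub_up]
    exact (comp_case _ _ _ _).symm
  | lam M ih =>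
    simp only [Tm.subst, tm, ih, sub_up]
    exact (comp_curry_swap _ _).symm
  | app M N ih₁ ih₂ =>
    simp only [Tm.subst, tm, ih₁, ih₂]
    exact (comp_lift_assoc _ _ _ _).symm
  | fix M ih =>
    simp only [Tm.subst, tm, ih, sub_up]
    exact (LiftingMonad.Strength.comp_dagger _
      (LiftingMonad.Strength.unit_algExp _ _ (𝒜.T.unit_ext _ _ _)) _ _).symm
  | op _ _ ih | fst _ ih | snd _ ih | caseEmpty _ ih | inl _ ih | inr _ ih =>
    exact (congrArg (· ≫ _) (ih s)).trans (Category.assoc _ _ _)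

/-! ### Environments and substitution in formulas -/

variable {𝒜}

/-- The generalised environment `⟨γ, y⟩`. It is `lift γ y` with codomain recorded as the
interpretation of a context, rather than as a product. -/
noncomputable def cons {X : C} {Γ : Ctx S} {σ : Ty S.Base} (γ : X ⟶ 𝒜.ctx Γ) (y : X ⟶ 𝒜.ty σ) :
    X ⟶ 𝒜.ctx (σ :: Γ) :=
  lift γ y

theorem exists_eq_cons {X : C} {Γ : Ctx S} {σ : Ty S.Base} (p : X ⟶ 𝒜.ctx (σ :: Γ)) :
    ∃ γ y, p = cons (σ := σ) γ y :=
  ⟨p ≫ fst (𝒜.ctx Γ) (𝒜.ty σ), p ≫ snd (𝒜.ctx Γ) (𝒜.ty σ), (lift_comp_fst_snd _).symm⟩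

theorem cons_fst {X : C} {Γ : Ctx S} {σ : Ty S.Base} (γ : X ⟶ 𝒜.ctx Γ) (y : X ⟶ 𝒜.ty σ) :
    cons γ y ≫ fst (𝒜.ctx Γ) (𝒜.ty σ) = γ :=
  lift_fst _ _

theorem cons_snd {X : C} {Γ : Ctx S} {σ : Ty S.Base} (γ : X ⟶ 𝒜.ctx Γ) (y : X ⟶ 𝒜.ty σ) :
    cons γ y ≫ snd (𝒜.ctx Γ) (𝒜.ty σ) = y :=
  lift_snd _ _

/-- The application of a generalised element `f` of a function type to `x`. -/
noncomputable def apply {X : C} {σ : Ty S.Base} (f : X ⟶ 𝒜.ty (.arr σ)) (x : X ⟶ 𝒜.ty σ) :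
    X ⟶ 𝒜.ty .prop :=
  lift x f ≫ (ihom.ev (𝒜.ty σ)).app 𝒜.Ω

theorem comp_sub {X : C} {Γ Δ : Ctx S} {σ : Ty S.Base} (s : Subst (σ :: Γ) Δ) (δ : X ⟶ 𝒜.ctx Δ) :
    δ ≫ 𝒜.sub s = cons (δ ≫ 𝒜.sub fun _ x => s _ (.succ x)) (δ ≫ 𝒜.tm (s _ .zero)) :=
  comp_lift _ _ _

theorem cons_sub_up {X : C} {Γ Δ : Ctx S} {σ : Ty S.Base} (s : Subst Γ Δ) (δ : X ⟶ 𝒜.ctx Δ)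
    (y : X ⟶ 𝒜.ty σ) : cons δ y ≫ 𝒜.sub (s.up σ) = cons (δ ≫ 𝒜.sub s) y := by
  rw [sub_up]
  exact lift_whiskerRight _ _ _

theorem sub_var_id {Γ : Ctx S} : 𝒜.sub (fun _ (x : Var Γ _) => Tm.var x) = 𝟙 (𝒜.ctx Γ) :=
  𝒜.ctx_hom_ext fun _ x => (𝒜.sub_var _ x).trans (Category.id_comp _).symm

theorem comp_sub_single {X : C} {Γ : Ctx S} {τ : Ty S.Base} (M : Tm S Γ τ) (γ : X ⟶ 𝒜.ctx Γ) :
    γ ≫ 𝒜.sub (Subst.single M) = cons γ (γ ≫ 𝒜.tm M) := by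
  rw [comp_sub]
  exact congrArg (cons · _) ((congrArg (γ ≫ ·) sub_var_id).trans (Category.comp_id γ))

theorem cons_sub_replace {X : C} {Γ : Ctx S} {σ τ : Ty S.Base} (M : Tm S (σ :: Γ) τ)
    (γ : X ⟶ 𝒜.ctx Γ) (x : X ⟶ 𝒜.ty σ) :
    cons γ x ≫ 𝒜.sub (Subst.replace M) = cons γ (cons γ x ≫ 𝒜.tm M) := by
  rw [comp_sub]
  exact congrArg (cons · _) ((congrArg (cons γ x ≫ ·) 𝒜.sub_wk).trans (cons_fst γ x))

variable (ℐ : 𝒜.PredInterp)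

theorem mem_form_subst {Γ Δ : Ctx S} (s : Subst Γ Δ) (φ : Form S Γ) (δ : 𝟙_ C ⟶ 𝒜.ctx Δ) :
    δ ∈ form ℐ (φ.subst s) ↔ δ ≫ 𝒜.sub s ∈ form ℐ φ := by
  induction φ with
  | atom p M =>
    change δ ≫ 𝒜.tm (M.subst s) ∈ atom ℐ p ↔ (δ ≫ 𝒜.sub s) ≫ 𝒜.tm M ∈ atom ℐ p
    rw [tm_subst, Category.assoc]
  | top => exact Iff.rfl
  | bot => exact Iff.rfl
  | imp φ ψ ih₁ ih₂ => exact imp_congr ih₁ ih₂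
  | and φ ψ ih₁ ih₂ => exact and_congr ih₁ ih₂
  | or φ ψ ih₁ ih₂ => exact or_congr ih₁ ih₂

/-! ### Refinement types at a pair of an environment and a value -/

section Membership

variable {Γ : Ctx S} {σ τ : Ty S.Base} (P : Pred (𝒜.ctx Γ)) (γ : 𝟙_ C ⟶ 𝒜.ctx Γ)

theorem cons_mem_refine (hσ : σ.IsGround) (φ : Form S (σ :: Γ)) (y : 𝟙_ C ⟶ 𝒜.ty σ) :
    cons γ y ∈ rty ℐ P (.refine σ hσ φ) ↔ γ ∈ P ∧ cons γ y ∈ form ℐ φ := by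
  change (cons γ y ≫ fst (𝒜.ctx Γ) (𝒜.ty σ) ∈ P ∧ _) ↔ _
  rw [cons_fst]
  exact Iff.rfl

theorem cons_mem_sigma (A : RTy S Γ σ) (B : RTy S (σ :: Γ) τ)
    (y : 𝟙_ C ⟶ 𝒜.ty (.prod σ τ)) :
    cons γ y ∈ rty ℐ P (.sigma A B) ↔
      cons (cons γ (y ≫ fst (𝒜.ty σ) (𝒜.ty τ))) (y ≫ snd (𝒜.ty σ) (𝒜.ty τ)) ∈
        rty ℐ (rty ℐ P A) B := by
  have h {X Y Z : C} (g : 𝟙_ C ⟶ X) (y : 𝟙_ C ⟶ Y ⊗ Z) : lift g y ≫ (α_ X Y Z).inv =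
      lift (lift g (y ≫ fst Y Z)) (y ≫ snd Y Z) := by
    ext <;> simp
  exact iff_of_eq (congrArg (· ∈ rty ℐ (rty ℐ P A) B) (h _ _))

theorem cons_mem_sum (A : RTy S Γ σ) (B : RTy S Γ τ) (y : 𝟙_ C ⟶ 𝒜.ty (.sum σ τ)) :
    cons γ y ∈ rty ℐ P (.sum A B) ↔
      (∃ x : 𝟙_ C ⟶ 𝒜.ty σ, cons γ x ∈ rty ℐ P A ∧ x ≫ inl (𝒜.ty σ) (𝒜.ty τ) = y) ∨
      ∃ x : 𝟙_ C ⟶ 𝒜.ty τ, cons γ x ∈ rty ℐ P B ∧ x ≫ inr (𝒜.ty σ) (𝒜.ty τ) = y := by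
  have key {X Y Z : C} (Q : Pred (X ⊗ Y)) (i : Y ⟶ Z) (g : 𝟙_ C ⟶ X) (z : 𝟙_ C ⟶ Z) :
      lift g z ∈ (fun f : 𝟙_ C ⟶ X ⊗ Y => f ≫ X ◁ i) '' Q ↔
        ∃ x : 𝟙_ C ⟶ Y, lift g x ∈ Q ∧ x ≫ i = z := by
    constructor
    · rintro ⟨f, hf, h⟩
      obtain rfl : f ≫ fst X Y = g := by simpa using congrArg (· ≫ fst X Z) h
      refine ⟨f ≫ snd X Y, by rwa [lift_comp_fst_snd], ?_⟩
      simpa using congrArg (· ≫ snd X Z) h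
    · rintro ⟨x, hx, rfl⟩
      exact ⟨_, hx, lift_whiskerLeft _ _ _⟩
  exact or_congr (key _ _ _ _) (key _ _ _ _)

/-- The condition `⟨γ, x⟩ ∈ ⟦A⟧` that the codomain `{v : Prop | φ}` repeats is dropped. -/
theorem cons_mem_pi (A : RTy S Γ σ) (φ : Form S (.prop :: σ :: Γ)) (f : 𝟙_ C ⟶ 𝒜.ty (.arr σ)) :
    cons γ f ∈ rty ℐ P (.pi A φ) ↔ γ ∈ P ∧ ∀ x : 𝟙_ C ⟶ 𝒜.ty σ, cons γ x ∈ rty ℐ P A →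
      cons (cons γ x) (apply f x) ∈ form ℐ φ := by
  change (cons γ f ≫ fst (𝒜.ctx Γ) (𝒜.ty (.arr σ)) ∈ P ∧ ∀ x : 𝟙_ C ⟶ 𝒜.ty σ,
    cons (cons γ f ≫ fst (𝒜.ctx Γ) (𝒜.ty (.arr σ))) x ∈ rty ℐ P A →
      cons (cons (cons γ f ≫ fst (𝒜.ctx Γ) (𝒜.ty (.arr σ))) x)
        (apply (cons γ f ≫ snd (𝒜.ctx Γ) (𝒜.ty (.arr σ))) x) ∈
          rty ℐ (rty ℐ P A) (.prop φ)) ↔ _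
  simp only [cons_fst, cons_snd]
  exact and_congr_right fun _ => forall₂_congr fun x hx =>
    (cons_mem_refine ℐ _ _ _ _ _).trans (and_iff_right hx)

end Membership

/-! ### Substitution in refinement types -/

/-- Substitution in a refinement type is interpreted by inverse image. -/
theorem rty_subst {Γ Δ : Ctx S} {σ : Ty S.Base} (s : Subst Γ Δ) (P : Pred (𝒜.ctx Γ))
    (A : RTy S Γ σ) :
    rty ℐ {δ | δ ≫ 𝒜.sub s ∈ P} (A.subst s) = {p | p ≫ 𝒜.sub (s.up σ) ∈ rty ℐ P A} := by
  induction A generalizing Δ with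
  | refine σ hσ φ =>
    ext p
    obtain ⟨δ, y, rfl⟩ := exists_eq_cons p
    simp only [RTy.subst, cons_mem_refine, mem_form_subst, Set.mem_ofPred_eq, cons_sub_up]
  | sigma A B ihA ihB =>
    ext p
    obtain ⟨δ, y, rfl⟩ := exists_eq_cons p
    simp only [RTy.subst, cons_mem_sigma, ihA, ihB, Set.mem_ofPred_eq, cons_sub_up]
  | empty => rfl
  | sum A₁ A₂ ih₁ ih₂ =>
    ext p
    obtain ⟨δ, y, rfl⟩ := exists_eq_cons p
    simp only [RTy.subst, cons_mem_sum, ih₁, ih₂, Set.mem_ofPred_eq, cons_sub_up]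
  | pi A φ ih =>
    ext p
    obtain ⟨δ, y, rfl⟩ := exists_eq_cons p
    simp only [RTy.subst, cons_mem_pi, ih, mem_form_subst, Set.mem_ofPred_eq, cons_sub_up]

/-- The interpretation over a context predicate `P` is the restriction to `P` of the interpretation
over the whole context. -/
theorem mem_rty_iff {Γ : Ctx S} {σ : Ty S.Base} (P : Pred (𝒜.ctx Γ)) (A : RTy S Γ σ)
    (γ : 𝟙_ C ⟶ 𝒜.ctx Γ) (y : 𝟙_ C ⟶ 𝒜.ty σ) :
    cons γ y ∈ rty ℐ P A ↔ γ ∈ P ∧ cons γ y ∈ rty ℐ Set.univ A := by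
  induction A with
  | refine σ hσ φ => simp [cons_mem_refine]
  | sigma A B ihA ihB =>
    rw [cons_mem_sigma, cons_mem_sigma, ihB, ihA, and_assoc, ← ihB]
  | empty => exact ⟨False.elim, fun h => h.2.elim⟩
  | sum A₁ A₂ ih₁ ih₂ =>
    simp only [cons_mem_sum, ih₁ P, ih₂ P]
    grind
  | pi A φ ih =>
    simp only [cons_mem_pi, ih P]
    grind

/-- The pointwise form of `rty_subst`, for arbitrary predicates on the two contexts that hold at the
environments in question. -/
theorem cons_mem_rty_subst {Γ Δ : Ctx S} {σ : Ty S.Base} {s : Subst Γ Δ} {P : Pred (𝒜.ctx Γ)}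
    {Q : Pred (𝒜.ctx Δ)} {A : RTy S Γ σ} {δ : 𝟙_ C ⟶ 𝒜.ctx Δ} {y : 𝟙_ C ⟶ 𝒜.ty σ}
    (hQ : δ ∈ Q) (hP : δ ≫ 𝒜.sub s ∈ P) :
    cons δ y ∈ rty ℐ Q (A.subst s) ↔ cons (δ ≫ 𝒜.sub s) y ∈ rty ℐ P A := by
  rw [← cons_sub_up, ← Set.mem_ofPred_eq (p := fun p => p ≫ 𝒜.sub (s.up σ) ∈ rty ℐ P A),
    ← rty_subst, mem_rty_iff ℐ Q, mem_rty_iff ℐ {δ | δ ≫ 𝒜.sub s ∈ P}]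
  simp [hQ, hP]

theorem cons_mem_rty_inst {Γ : Ctx S} {σ τ : Ty S.Base} {P : Pred (𝒜.ctx Γ)}
    {Q : Pred (𝒜.ctx (τ :: Γ))} {A : RTy S (τ :: Γ) σ} {M : Tm S Γ τ}
    {γ : 𝟙_ C ⟶ 𝒜.ctx Γ} {y : 𝟙_ C ⟶ 𝒜.ty σ}
    (hP : γ ∈ P) (hQ : cons γ (γ ≫ 𝒜.tm M) ∈ Q) :
    cons γ y ∈ rty ℐ P (A.inst M) ↔ cons (cons γ (γ ≫ 𝒜.tm M)) y ∈ rty ℐ Q A := by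
  rw [RTy.inst, ← comp_sub_single]
  exact cons_mem_rty_subst ℐ hP (by rwa [comp_sub_single])

theorem cons_mem_rty_wk {Γ : Ctx S} {σ τ : Ty S.Base} {P : Pred (𝒜.ctx Γ)}
    {Q : Pred (𝒜.ctx (τ :: Γ))} {A : RTy S Γ σ} {γ : 𝟙_ C ⟶ 𝒜.ctx Γ} {x : 𝟙_ C ⟶ 𝒜.ty τ}
    {y : 𝟙_ C ⟶ 𝒜.ty σ} (hP : γ ∈ P) (hQ : cons γ x ∈ Q) :
    cons (cons γ x) y ∈ rty ℐ Q A.wk ↔ cons γ y ∈ rty ℐ P A := by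
  have h : cons γ x ≫ 𝒜.sub (Ren.wk (Γ := Γ) (τ := τ)).toSubst = γ := by
    rw [sub_wk, cons_fst]
  rw [RTy.wk, cons_mem_rty_subst ℐ (P := P) hQ (by rwa [h]), h]

/-! ### Subtyping -/

theorem subTy_sound {Γ : Ctx S} {σ : Ty S.Base} {G : RCtx S Γ} {A B : RTy S Γ σ}
    (h : SubTy ℐ G A B) : rty ℐ (rctx ℐ G) A ⊆ rty ℐ (rctx ℐ G) B := by
  induction h with
  | refl => exact subset_rfl
  | trans _ _ ih₁ ih₂ => exact ih₁.trans ih₂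
  | refine hσ h => exact fun p hp => ⟨hp.1, h p hp.1 hp.2⟩
  | pi _ _ ih₁ ih₂ =>
    intro p hp
    obtain ⟨γ, f, rfl⟩ := exists_eq_cons p
    rw [cons_mem_pi] at hp ⊢
    refine ⟨hp.1, fun x hx => ?_⟩
    exact ((cons_mem_refine ℐ _ _ _ _ _).1
      (ih₂ ((cons_mem_refine ℐ _ _ _ _ _).2 ⟨hx, hp.2 x (ih₁ hx)⟩))).2
  | sigma _ _ ih₁ ih₂ =>
    intro p hp
    obtain ⟨γ, y, rfl⟩ := exists_eq_cons p
    rw [cons_mem_sigma] at hp ⊢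
    -- The hypothesis on `B₁ <: B₂` lands over `⟦A₁⟧`; the context predicate is then changed to `⟦A₂⟧`.
    have h₁ := (mem_rty_iff ℐ _ _ _ _).1 hp
    have h₂ := (mem_rty_iff ℐ _ _ _ _).1 (ih₂ hp)
    exact (mem_rty_iff ℐ _ _ _ _).2 ⟨ih₁ h₁.1, h₂.2⟩
  | sum _ _ ih₁ ih₂ =>
    exact Set.union_subset_union (Set.image_mono ih₁) (Set.image_mono ih₂)

/-! ### Terms at an environment, and soundness of typing -/

section Terms

variable {X : C} {Γ : Ctx S} {σ τ : Ty S.Base} (γ : X ⟶ 𝒜.ctx Γ)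

theorem comp_tm_app (M : Tm S Γ (.arr σ)) (N : Tm S Γ σ) :
    γ ≫ 𝒜.tm (.app M N) = apply (γ ≫ 𝒜.tm M) (γ ≫ 𝒜.tm N) :=
  comp_lift_assoc _ _ _ _

theorem apply_comp_tm_lam (M : Tm S (σ :: Γ) .prop) (x : X ⟶ 𝒜.ty σ) :
    apply (γ ≫ 𝒜.tm (.lam M)) x = cons γ x ≫ 𝒜.tm M :=
  lift_comp_curry_swap_ev _ _ _

theorem comp_tm_fst (M : Tm S Γ (.prod σ τ)) :
    (γ ≫ 𝒜.tm M) ≫ fst (𝒜.ty σ) (𝒜.ty τ) = γ ≫ 𝒜.tm (.fst M) :=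
  Category.assoc _ _ _

theorem comp_tm_snd (M : Tm S Γ (.prod σ τ)) :
    (γ ≫ 𝒜.tm M) ≫ snd (𝒜.ty σ) (𝒜.ty τ) = γ ≫ 𝒜.tm (.snd M) :=
  Category.assoc _ _ _

theorem comp_tm_pair_fst (M : Tm S Γ σ) (N : Tm S Γ τ) :
    (γ ≫ 𝒜.tm (.pair M N)) ≫ fst (𝒜.ty σ) (𝒜.ty τ) = γ ≫ 𝒜.tm M :=
  (Category.assoc _ _ _).trans (congrArg (γ ≫ ·) (lift_fst _ _))

theorem comp_tm_pair_snd (M : Tm S Γ σ) (N : Tm S Γ τ) :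
    (γ ≫ 𝒜.tm (.pair M N)) ≫ snd (𝒜.ty σ) (𝒜.ty τ) = γ ≫ 𝒜.tm N :=
  (Category.assoc _ _ _).trans (congrArg (γ ≫ ·) (lift_snd _ _))

theorem cons_tm_var_zero (x : X ⟶ 𝒜.ty σ) : cons γ x ≫ 𝒜.tm (.var .zero) = x :=
  cons_snd γ x

theorem cons_tm_var_succ (x : X ⟶ 𝒜.ty σ) (y : Var Γ τ) :
    cons γ x ≫ 𝒜.tm (.var (.succ y)) = γ ≫ 𝒜.var y :=
  (Category.assoc _ _ _).symm.trans (congrArg (· ≫ 𝒜.var y) (cons_fst γ x))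

theorem cons_tm_inl_var_zero (x : X ⟶ 𝒜.ty σ) :
    cons γ x ≫ 𝒜.tm (.inl (.var .zero)) = x ≫ inl (𝒜.ty σ) (𝒜.ty τ) :=
  (Category.assoc _ _ _).symm.trans (congrArg (· ≫ inl (𝒜.ty σ) (𝒜.ty τ)) (cons_snd γ x))

theorem cons_tm_inr_var_zero (x : X ⟶ 𝒜.ty τ) :
    cons γ x ≫ 𝒜.tm (.inr (.var .zero)) = x ≫ inr (𝒜.ty σ) (𝒜.ty τ) :=
  (Category.assoc _ _ _).symm.trans (congrArg (· ≫ inr (𝒜.ty σ) (𝒜.ty τ)) (cons_snd γ x))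

end Terms

theorem var_sound {Γ : Ctx S} {σ : Ty S.Base} (G : RCtx S Γ) (x : Var Γ σ)
    {γ : 𝟙_ C ⟶ 𝒜.ctx Γ} (hγ : γ ∈ rctx ℐ G) :
    cons γ (γ ≫ 𝒜.var x) ∈ rty ℐ (rctx ℐ G) (G.lookup x) := by
  induction x with
  | zero =>
    cases G with | snoc G A =>
    obtain ⟨γ, y, rfl⟩ := exists_eq_cons γ
    have h := ((mem_rty_iff ℐ (rctx ℐ G) A γ y).1 hγ).1
    rw [RCtx.lookup, cons_mem_rty_wk ℐ h hγ, var, cons_snd]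
    exact hγ
  | succ x ih =>
    cases G with | snoc G A =>
    obtain ⟨γ, y, rfl⟩ := exists_eq_cons γ
    have h := ((mem_rty_iff ℐ (rctx ℐ G) A γ y).1 hγ).1
    rw [RCtx.lookup, cons_mem_rty_wk ℐ h hγ, ← tm, cons_tm_var_succ]
    exact ih G h

/-- Soundness of the rule for fixed points, by Scott induction on the set of `f` with
`⟨γ, f⟩ ∈ ⟦(x : A) → {v : Prop | φ}⟧`. -/
theorem fix_mem_pi {Γ : Ctx S} {σ : Ty S.Base} {P : Pred (𝒜.ctx Γ)} {A : RTy S Γ σ}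
    {φ : Form S (.prop :: σ :: Γ)} (hφ : 𝒜.Admissible (form ℐ φ) .zero)
    {M : Tm S (.arr σ :: Γ) (.arr σ)} {γ : 𝟙_ C ⟶ 𝒜.ctx Γ} (hγ : γ ∈ P)
    (hM : ∀ f : 𝟙_ C ⟶ 𝒜.ty (.arr σ), cons γ f ∈ rty ℐ P (.pi A φ) →
      cons γ (cons γ f ≫ 𝒜.tm M) ∈ rty ℐ P (.pi A φ)) :
    cons γ (γ ≫ 𝒜.tm (.fix M)) ∈ rty ℐ P (.pi A φ) := by
  -- `Admissible` quantifies over environments that already assign a value to the updated variable;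
  -- the value `⊥` used here is irrelevant.
  have hupd (δ : 𝟙_ C ⟶ 𝒜.ctx (σ :: Γ)) (u : 𝟙_ C ⟶ 𝒜.Ω) :
      𝒜.update (cons (σ := .prop) δ 𝒜.botΩ) .zero u = cons (σ := .prop) δ u :=
    congrArg (cons (σ := .prop) · u) (cons_fst (σ := .prop) δ 𝒜.botΩ)
  refine 𝒜.str.comp_dagger_mem (Q := {f | cons (σ := .arr σ) γ f ∈ rty ℐ P (.pi A φ)})
    (𝒜.str.unit_algExp (𝒜.ty σ) (𝒜.T.unit_ext _ _ _)) ?_ hM fun d hd => ?_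
  · refine (cons_mem_pi ℐ _ _ _ _ _).2 ⟨hγ, fun x _ => ?_⟩
    have h := hφ.1 (cons (σ := .prop) (cons γ x) 𝒜.botΩ)
    rw [hupd] at h
    exact Set.mem_of_eq_of_mem (congrArg (cons (σ := .prop) (cons γ x))
      ((𝒜.str.bot_algExp_ev _ x).trans (𝒜.T.bot_ext _ _ _))) h
  · refine (cons_mem_pi ℐ _ _ _ _ _).2 ⟨hγ, fun x hx => ?_⟩
    have hcont : ωScottContinuous (fun f : 𝟙_ C ⟶ (ihom (𝒜.ty σ)).obj 𝒜.Ω =>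
        lift x f ≫ (ihom.ev (𝒜.ty σ)).app 𝒜.Ω) :=
      (comp_right_continuous _).comp (lift_right_continuous _)
    have h := hφ.2 (cons (σ := .prop) (cons γ x) 𝒜.botΩ) (d.map ⟨_, hcont.monotone⟩) fun n => by
      rw [hupd]
      exact ((cons_mem_pi ℐ _ _ _ _ _).1 (hd n)).2 x hx
    exact Set.mem_of_eq_of_mem ((congrArg (cons (σ := .prop) (cons γ x)) (hcont.map_ωSup d)).trans
      (hupd _ _).symm) h

theorem hasType_sound {Γ : Ctx S} {σ : Ty S.Base} {G : RCtx S Γ} {M : Tm S Γ σ} {A : RTy S Γ σ}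
    (h : HasType ℐ G M A) {γ : 𝟙_ C ⟶ 𝒜.ctx Γ} (hγ : γ ∈ rctx ℐ G) :
    cons γ (γ ≫ 𝒜.tm M) ∈ rty ℐ (rctx ℐ G) A := by
  induction h with
  | sub _ hAB ih => exact subTy_sound ℐ hAB (ih hγ)
  | @app Γ σ G M N A φ _ _ ihM ihN =>
    rw [cons_mem_rty_inst ℐ hγ (ihN hγ), comp_tm_app]
    exact (cons_mem_refine ℐ _ _ _ _ _).2
      ⟨ihN hγ, ((cons_mem_pi ℐ _ _ _ _ _).1 (ihM hγ)).2 _ (ihN hγ)⟩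
  | @lam Γ σ G A M φ _ ih =>
    refine (cons_mem_pi ℐ _ _ _ _ _).2 ⟨hγ, fun x hx => ?_⟩
    rw [apply_comp_tm_lam]
    exact ((cons_mem_refine ℐ _ _ _ _ _).1 (ih hx)).2
  | unit => exact (cons_mem_refine ℐ _ _ _ _ _).2 ⟨hγ, trivial⟩
  | @pair Γ σ τ G M N A B _ _ ihM ihN =>
    rw [cons_mem_sigma, comp_tm_pair_fst, comp_tm_pair_snd]
    exact (cons_mem_rty_inst ℐ hγ (ihM hγ)).1 (ihN hγ)
  | @fst Γ σ τ G M A B _ ih =>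
    have h := (mem_rty_iff ℐ _ _ _ _).1 ((cons_mem_sigma ℐ _ _ _ _ _).1 (ih hγ))
    rw [comp_tm_fst] at h
    exact h.1
  | @snd Γ σ τ G M A B _ ih =>
    have h := (cons_mem_sigma ℐ _ _ _ _ _).1 (ih hγ)
    rw [comp_tm_fst, comp_tm_snd] at h
    exact (cons_mem_rty_inst ℐ hγ ((mem_rty_iff ℐ _ _ _ _).1 h).1).2 h
  | caseEmpty B _ ih => exact (ih hγ).elim
  | @inl Γ σ₁ σ₂ G M A₁ A₂ _ ih =>
    exact (cons_mem_sum ℐ _ _ _ _ _).2 (.inl ⟨_, ih hγ, Category.assoc _ _ _⟩)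
  | @inr Γ σ₁ σ₂ G M A₁ A₂ _ ih =>
    exact (cons_mem_sum ℐ _ _ _ _ _).2 (.inr ⟨_, ih hγ, Category.assoc _ _ _⟩)
  | @caseSum Γ σ₁ σ₂ τ G M N₁ N₂ A₁ A₂ B _ _ _ ih ih₁ ih₂ =>
    rw [cons_mem_rty_inst ℐ hγ (ih hγ)]
    have hM := ih hγ
    rcases (cons_mem_sum ℐ _ _ _ _ _).1 hM with ⟨x, hx, h⟩ | ⟨x, hx, h⟩
    · have hN : γ ≫ 𝒜.tm (.caseSum M N₁ N₂) = cons γ x ≫ 𝒜.tm N₁ :=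
        comp_case_of_inl h _ _
      have hs : cons γ x ≫ 𝒜.sub (Subst.replace (.inl (.var .zero))) = cons γ (γ ≫ 𝒜.tm M) := by
        rw [cons_sub_replace, cons_tm_inl_var_zero, h]
      rw [hN, ← hs]
      rw [← hs] at hM
      exact (cons_mem_rty_subst ℐ hx hM).1 (ih₁ hx)
    · have hN : γ ≫ 𝒜.tm (.caseSum M N₁ N₂) = cons γ x ≫ 𝒜.tm N₂ :=
        comp_case_of_inr h _ _
      have hs : cons γ x ≫ 𝒜.sub (Subst.replace (.inr (.var .zero))) = cons γ (γ ≫ 𝒜.tm M) := by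
        rw [cons_sub_replace, cons_tm_inr_var_zero, h]
      rw [hN, ← hs]
      rw [← hs] at hM
      exact (cons_mem_rty_subst ℐ hx hM).1 (ih₂ hx)
  | @varRefine Γ t G x φ _ =>
    refine (cons_mem_refine ℐ _ _ _ _ _).2 ⟨hγ, ?_⟩
    have h : (cons γ (γ ≫ 𝒜.var x) ≫ 𝒜.tm (.pair (.var .zero) (.var (.succ x)))) ≫
        fst (𝒜.ty (.base t)) (𝒜.ty (.base t)) =
        (cons γ (γ ≫ 𝒜.var x) ≫ 𝒜.tm (.pair (.var .zero) (.var (.succ x)))) ≫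
        snd (𝒜.ty (.base t)) (𝒜.ty (.base t)) := by
      rw [comp_tm_pair_fst, comp_tm_pair_snd, cons_tm_var_zero, cons_tm_var_succ]
    exact h
  | var G x => exact var_sound ℐ G x hγ
  | fix _ hφ ih =>
    exact fix_mem_pi ℐ hφ hγ fun f hf => (cons_mem_rty_wk ℐ hγ hf).1 (ih hf)
  | @op Γ G o M A B _ hop ih =>
    have h : lift γ (γ ≫ 𝒜.tm (.op o M)) = lift γ (γ ≫ 𝒜.tm M) ≫ 𝒜.ctx Γ ◁ 𝒜.op o := by
      rw [lift_whiskerLeft, Category.assoc]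
      rfl
    exact Set.mem_of_eq_of_mem h (hop _ (ih hγ))

end Model

end HFL

theorem theorem1 {C : Type u} [Category.{v} C] [CartesianMonoidalCategory C] [MonoidalClosed C]
    [HFL.FiniteCoproducts C] [HFL.OmegaCPOEnriched C] {S : HFL.Signature.{a, b, c}}
    (𝒜 : HFL.Model S C) (ℐ : 𝒜.PredInterp) {Γ : HFL.Ctx S} {σ : HFL.Ty S.Base}
    (G : HFL.RCtx S Γ) (M : HFL.Tm S Γ σ) (A : HFL.RTy S Γ σ)
    (h : HFL.Model.HasType ℐ G M A)
    (γ : 𝟙_ C ⟶ 𝒜.ctx Γ) (hγ : γ ∈ HFL.Model.rctx ℐ G) :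
    lift γ (γ ≫ 𝒜.tm M) ∈ HFL.Model.rctx ℐ (G.snoc A) :=
  HFL.Model.hasType_sound ℐ h hγ
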